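/- Throughout, C*-algebras are complex, unital, and $*$-homomorphisms are unital; $\otimes$ is the minimal C*-tensor product. A *Woronowicz algebra* (compact quantum group) is a nonzero unital C*-algebra $A$ together with a $*$-homomorphism $\Delta : A \to A \otimes A$ and a family $(u^\lambda)_{\lambda\in\Lambda}$ of unitary matrices $u^\lambda \in M_{d_\lambda}(A)$ such that: (1) the subalgebra $\mathcal A$ generated by the entries $u^\lambda_{ij}$ is dense in $A$; (2) $\Delta(u^\lambda_{ij}) = \sum_{k} u^\lambda_{ik} \otimes u^\lambda_{kj}$ for all $\lambda, i, j$; (3) each transpose ${}^t u^\lambda$ is invertible. The algebra $\mathcal A$ is a $*$-subalgebra, and $A$ is called *full* if $A$ is the enveloping C*-algebra of $\mathcal A$, i.e. the norm of $A$ restricted to $\mathcal A$ is the largest C*-seminorm on $\mathcal A$. For $n \geq 1$, let $\mathcal A_t(n)$ be the universal complex algebra with generators $x_{ij}$, $1\le i,j\le n$, and relations $x_{ij}x_{ik} = \delta_{jk}x_{ij}$, $x_{ji}x_{ki} = \delta_{jk}x_{ji}$, $\sum_{l} x_{il} = 1 = \sum_{l} x_{li}$, with the involution $x_{ij}^* =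 x_{ij}$, and let $A_{aut}(X_n)$ be its enveloping C*-algebra. For a Woronowicz algebra $A$, let $A^{*n}$ be the free product (coproduct of unital C*-algebras) of $n$ copies of $A$, with canonical maps $\nu_i : A \to A^{*n}$, $1 \le i \le n$. The *free wreath product* $A *_w A_{aut}(X_n)$ is the quotient of the free product C*-algebra $A^{*n} * A_{aut}(X_n)$ by the closed two-sided ideal generated by the elements $$\nu_k(a)x_{ki} - x_{ki}\nu_k(a), \qquad 1 \le i,k \le n,\ a \in A;$$ the images of $\nu_i(a)$ and $x_{ij}$ in it are denoted by the same symbols. **Theorem 3.2.** Let $n \geq 1$ and let $A$ be a Woronowicz algebra with coproduct $\Delta_A$. Then the C*-algebra $A *_w A_{aut}(X_n)$ admits a Woronowicz algebra structure whose coproduct $\Delta$ satisfies, for all $a \in A$ and $1 \le i,j \le n$, $$\Delta(x_{ij}) = \sum_{k=1}^n x_{ik}\otimes x_{kj}, \qquad \Delta(\nu_i(a)) = \sum_{k=1}^n (\nu_i\otimes\nu_k)(\Delta_A(a))\,(x_{ik}\otimes 1).$$ If moreover $A$ is full, then so is $A *_w A_{aut}(X_n)$ with this structure. -/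

import Mathlib

open scoped TensorProduct

universe u v w

noncomputable section

/-- A C*-seminorm on a unital complex `*`-algebra: a seminorm `q` with `q (a b) ≤ q a * q b` and
`q (a* a) = (q a)²`. -/
structure CStarSeminorm (𝒜 : Type u) [Ring 𝒜] [StarRing 𝒜] [Algebra ℂ 𝒜] extends
    Seminorm ℂ 𝒜 where
  mul_le' : ∀ a b : 𝒜, toFun (a * b) ≤ toFun a * toFun b
  star_mul_self' : ∀ a : 𝒜, toFun (star a * a) = toFun a ^ 2

namespace CStarSeminorm

variable {𝒜 : Type u} [Ring 𝒜] [StarRing 𝒜] [Algebra ℂ 𝒜]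

instance : CoeFun (CStarSeminorm 𝒜) (fun _ => 𝒜 → ℝ) := ⟨fun q => q.toSeminorm⟩

theorem mul_le (q : CStarSeminorm 𝒜) (a b : 𝒜) : q (a * b) ≤ q a * q b := q.mul_le' a b

theorem star_mul_self (q : CStarSeminorm 𝒜) (a : 𝒜) : q (star a * a) = q a ^ 2 :=
  q.star_mul_self' a

theorem nonneg (q : CStarSeminorm 𝒜) (a : 𝒜) : 0 ≤ q a := apply_nonneg q.toSeminorm a

theorem le_star (q : CStarSeminorm 𝒜) (a : 𝒜) : q a ≤ q (star a) := by
  by_cases h : q a = 0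
  · rw [h]; exact q.nonneg _
  · have h1 := q.mul_le (star a) a
    rw [q.star_mul_self, pow_two] at h1
    exact le_of_mul_le_mul_right h1 (lt_of_le_of_ne (q.nonneg a) (Ne.symm h))

theorem star_eq (q : CStarSeminorm 𝒜) (a : 𝒜) : q (star a) = q a :=
  le_antisymm (by simpa using q.le_star (star a)) (q.le_star a)

/-- The `*`-algebra `𝒜`, regarded as a topological space through the C*-seminorm `q`. -/
def Space (_ : CStarSeminorm 𝒜) : Type u := 𝒜

variable (q : CStarSeminorm 𝒜)

instance : Ring q.Space := inferInstanceAs (Ring 𝒜)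
instance : StarRing q.Space := inferInstanceAs (StarRing 𝒜)
instance : Algebra ℂ q.Space := inferInstanceAs (Algebra ℂ 𝒜)
instance [h : StarModule ℂ 𝒜] : StarModule ℂ q.Space := h

instance : SeminormedRing q.Space :=
  { (inferInstance : Ring q.Space),
    q.toSeminorm.toAddGroupSeminorm.toSeminormedAddCommGroup with
    norm_mul_le := fun a b => q.mul_le a b }

theorem norm_def (a : q.Space) : ‖a‖ = q (show 𝒜 from a) := rfl

instance : NormedSpace ℂ q.Space where
  norm_smul_le c a := (map_smul_eq_mul q.toSeminorm c a).le

instance : NormedStarGroup q.Space where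
  norm_star_le a := (q.star_eq a).le

/-- The completion of `𝒜` with respect to the C*-seminorm `q` (elements at
`q`-distance `0` are identified). -/
def Completion : Type u := UniformSpace.Completion q.Space

namespace Completion

instance : NormedRing q.Completion := inferInstanceAs (NormedRing (UniformSpace.Completion q.Space))
instance : CompleteSpace q.Completion :=
  inferInstanceAs (CompleteSpace (UniformSpace.Completion q.Space))
instance : Algebra ℂ q.Completion := inferInstanceAs (Algebra ℂ (UniformSpace.Completion q.Space))
instance : NormedAlgebra ℂ q.Completion where
  norm_smul_le c x := by
    exact norm_smul_le (β := UniformSpace.Completion q.Space) c x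

/-- The canonical map into the completion. -/
def coe (a : 𝒜) : q.Completion := ((show q.Space from a : q.Space) : UniformSpace.Completion q.Space)

theorem denseRange_coe : DenseRange (coe q) :=
  UniformSpace.Completion.denseRange_coe (α := q.Space)

theorem norm_coe (a : 𝒜) : ‖coe q a‖ = q a := UniformSpace.Completion.norm_coe (E := q.Space) a

theorem coe_mul (a b : 𝒜) : coe q (a * b) = coe q a * coe q b :=
  UniformSpace.Completion.coe_mul (α := q.Space) a b
theorem coe_one : coe q 1 = 1 := rfl
theorem coe_add (a b : 𝒜) : coe q (a + b) = coe q a + coe q b :=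
  UniformSpace.Completion.coe_add (α := q.Space) a b
theorem coe_smul (c : ℂ) (a : 𝒜) : coe q (c • a) = c • coe q a :=
  UniformSpace.Completion.coe_smul (X := q.Space) c a

instance : Star q.Completion := ⟨UniformSpace.Completion.map (star : q.Space → q.Space)⟩

theorem uniformContinuous_star : UniformContinuous (star : q.Space → q.Space) :=
  (starNormedAddGroupHom (E := q.Space)).uniformContinuous

theorem continuous_star' : Continuous (star : q.Completion → q.Completion) :=
  UniformSpace.Completion.continuous_map

theorem coe_star (a : 𝒜) : coe q (star a) = star (coe q a) :=
  (UniformSpace.Completion.map_coe (uniformContinuous_star q) a).symm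

theorem ext_coe {X : Type w} [TopologicalSpace X] [T2Space X] {f g : q.Completion → X}
    (hf : Continuous f) (hg : Continuous g) (h : ∀ a, f (coe q a) = g (coe q a))
    (x : q.Completion) : f x = g x :=
  congrFun ((denseRange_coe q).equalizer hf hg (funext h)) x

theorem ext_coe₂ {X : Type w} [TopologicalSpace X] [T2Space X] {f g : q.Completion × q.Completion → X}
    (hf : Continuous f) (hg : Continuous g) (h : ∀ a b, f (coe q a, coe q b) = g (coe q a, coe q b))
    (x y : q.Completion) : f (x, y) = g (x, y) :=
  ext_coe q (f := fun x => f (x, y)) (g := fun x => g (x, y)) (by fun_prop) (by fun_prop)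
    (fun a => ext_coe q (f := fun y => f (coe q a, y)) (g := fun y => g (coe q a, y))
      (by fun_prop) (by fun_prop) (h a) y) x

instance : StarRing q.Completion where
  star_involutive x := by
    refine ext_coe q (f := fun x => star (star x)) (g := fun x => x) ?_ continuous_id ?_ x
    · exact (continuous_star' q).comp (continuous_star' q)
    · intro a
      rw [← coe_star, ← coe_star, star_star]
  star_mul x y := by
    have hs := continuous_star' q
    refine ext_coe₂ q (f := fun z => star (z.1 * z.2)) (g := fun z => star z.2 * star z.1)
      (by fun_prop) (by fun_prop) (fun a b => ?_) x y
    change star (coe q a * coe q b) = star (coe q b) * star (coe q a)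
    rw [← coe_mul, ← coe_star, ← coe_star, ← coe_star, star_mul, coe_mul]
  star_add x y := by
    have hs := continuous_star' q
    refine ext_coe₂ q (f := fun z => star (z.1 + z.2)) (g := fun z => star z.1 + star z.2)
      (by fun_prop) (by fun_prop) (fun a b => ?_) x y
    change star (coe q a + coe q b) = star (coe q a) + star (coe q b)
    rw [← coe_add, ← coe_star, ← coe_star, ← coe_star, star_add, coe_add]

instance : CStarRing q.Completion where
  norm_mul_self_le x := by
    refine (ext_coe q (f := fun x => ‖x‖ * ‖x‖) (g := fun x => ‖star x * x‖) ?_ ?_ ?_ x).le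
    · exact continuous_norm.mul continuous_norm
    · exact continuous_norm.comp ((continuous_star' q).mul continuous_id)
    · intro a
      rw [← coe_star, ← coe_mul, norm_coe, norm_coe, q.star_mul_self, pow_two]

instance [StarModule ℂ 𝒜] : StarModule ℂ q.Completion where
  star_smul c x := by
    refine ext_coe q (f := fun x => star (c • x)) (g := fun x => star c • star x) ?_ ?_ ?_ x
    · exact (continuous_star' q).comp (continuous_id.const_smul c)
    · exact (continuous_star' q).const_smul (star c)
    · intro a
      rw [← coe_smul, ← coe_star, ← coe_star, star_smul, coe_smul]

instance [StarModule ℂ 𝒜] : CStarAlgebra q.Completion where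

/-- The canonical `*`-homomorphism into the completion. -/
def of [StarModule ℂ 𝒜] : 𝒜 →⋆ₐ[ℂ] q.Completion where
  toFun := coe q
  map_one' := coe_one q
  map_mul' := coe_mul q
  map_zero' := UniformSpace.Completion.coe_zero
  map_add' := coe_add q
  commutes' c := by
    rw [Algebra.algebraMap_eq_smul_one, coe_smul, coe_one, ← Algebra.algebraMap_eq_smul_one]
  map_star' := coe_star q

theorem norm_of [StarModule ℂ 𝒜] (a : 𝒜) : ‖of q a‖ = q a := norm_coe q a

theorem denseRange_of [StarModule ℂ 𝒜] : DenseRange (of q) := denseRange_coe q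

section lift

variable {q} {B : Type w} [CStarAlgebra B]

theorem uniformContinuous_of_le (φ : 𝒜 →⋆ₐ[ℂ] B) (h : ∀ a, ‖φ a‖ ≤ q a) :
    UniformContinuous (fun a : q.Space => φ (show 𝒜 from a)) := by
  let ψ : q.Space →+ B :=
    { toFun := fun a => φ (show 𝒜 from a)
      map_zero' := map_zero φ
      map_add' := fun a b => map_add φ (show 𝒜 from a) (show 𝒜 from b) }
  exact (AddMonoidHomClass.lipschitz_of_bound ψ 1
    (fun a => by rw [one_mul]; exact h a)).uniformContinuous

/-- The continuous extension to the completion of a `*`-homomorphism bounded by `q`. -/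
def extend (φ : 𝒜 →⋆ₐ[ℂ] B) : q.Completion → B :=
  UniformSpace.Completion.extension (fun a : q.Space => φ (show 𝒜 from a))

theorem continuous_extend (φ : 𝒜 →⋆ₐ[ℂ] B) : Continuous (extend (q := q) φ) :=
  UniformSpace.Completion.continuous_extension

theorem extend_coe (φ : 𝒜 →⋆ₐ[ℂ] B) (h : ∀ a, ‖φ a‖ ≤ q a) (a : 𝒜) :
    extend φ (coe q a) = φ a :=
  UniformSpace.Completion.extension_coe (uniformContinuous_of_le φ h) a

/-- The extension to the completion of a `*`-homomorphism which is bounded by `q`,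
as a `*`-homomorphism. -/
def lift [StarModule ℂ 𝒜] (φ : 𝒜 →⋆ₐ[ℂ] B) (h : ∀ a, ‖φ a‖ ≤ q a) : q.Completion →⋆ₐ[ℂ] B where
  toFun := extend φ
  map_one' := (extend_coe φ h 1).trans (map_one φ)
  map_zero' := (extend_coe φ h 0).trans (map_zero φ)
  map_mul' x y := by
    have hs := continuous_extend (q := q) φ
    refine ext_coe₂ q (f := fun z => extend φ (z.1 * z.2))
      (g := fun z => extend φ z.1 * extend φ z.2)
      (by fun_prop) (by fun_prop) (fun a b => ?_) x y
    rw [← coe_mul, extend_coe φ h, extend_coe φ h, extend_coe φ h, map_mul]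
  map_add' x y := by
    have hs := continuous_extend (q := q) φ
    refine ext_coe₂ q (f := fun z => extend φ (z.1 + z.2))
      (g := fun z => extend φ z.1 + extend φ z.2)
      (by fun_prop) (by fun_prop) (fun a b => ?_) x y
    rw [← coe_add, extend_coe φ h, extend_coe φ h, extend_coe φ h, map_add]
  commutes' c := by
    rw [Algebra.algebraMap_eq_smul_one, ← coe_one, ← coe_smul, extend_coe φ h, map_smul, map_one,
      Algebra.algebraMap_eq_smul_one]
  map_star' x := by
    refine ext_coe q (f := fun x => extend φ (star x)) (g := fun x => star (extend φ x)) ?_ ?_ ?_ x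
    · exact (continuous_extend φ).comp (continuous_star' q)
    · exact continuous_star.comp (continuous_extend φ)
    · intro a
      rw [← coe_star, extend_coe φ h, extend_coe φ h, map_star]

theorem lift_of [StarModule ℂ 𝒜] (φ : 𝒜 →⋆ₐ[ℂ] B) (h : ∀ a, ‖φ a‖ ≤ q a) (a : 𝒜) :
    lift φ h (of q a) = φ a :=
  extend_coe φ h a

end lift

end Completion

end CStarSeminorm

/-- A `*`-algebra has an enveloping C*-algebra if at each element the values of all
C*-seminorms are bounded. -/
class HasCStarEnvelope (𝒜 : Type u) [Ring 𝒜] [StarRing 𝒜] [Algebra ℂ 𝒜] : Prop where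
  bddAbove : ∀ a : 𝒜, BddAbove (Set.range fun q : CStarSeminorm 𝒜 => q a)

namespace CStarSeminorm

variable {𝒜 : Type u} [Ring 𝒜] [StarRing 𝒜] [Algebra ℂ 𝒜]

/-- The zero C*-seminorm. -/
instance : Inhabited (CStarSeminorm 𝒜) :=
  ⟨{ (0 : Seminorm ℂ 𝒜) with
      mul_le' := fun _ _ => (mul_zero (0 : ℝ)).ge
      star_mul_self' := fun _ => (zero_pow (M₀ := ℝ) two_ne_zero).symm }⟩

/-- The pointwise supremum of a pointwise bounded nonempty family of C*-seminorms. -/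
def iSup {ι : Type v} [Nonempty ι] (q : ι → CStarSeminorm 𝒜)
    (h : ∀ a, BddAbove (Set.range fun i => q i a)) : CStarSeminorm 𝒜 :=
  have hle : ∀ i a, q i a ≤ ⨆ i, q i a := fun i a => le_ciSup (h a) i
  have h0 : ∀ a, 0 ≤ ⨆ i, q i a := fun a => Real.iSup_nonneg fun i => (q i).nonneg a
  { Seminorm.ofSMulLE (𝕜 := ℂ) (fun a => ⨆ i, q i a)
      (by simp)
      (fun a b => ciSup_le fun i =>
        (map_add_le_add (q i).toSeminorm a b).trans (add_le_add (hle i a) (hle i b)))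
      (fun c a => ciSup_le fun i => by
        rw [map_smul_eq_mul]
        exact mul_le_mul_of_nonneg_left (hle i a) (norm_nonneg c)) with
    mul_le' := fun a b => ciSup_le fun i => ((q i).mul_le a b).trans
      (mul_le_mul (hle i a) (hle i b) ((q i).nonneg b) (h0 a))
    star_mul_self' := fun a => by
      change (⨆ i, q i (star a * a)) = (⨆ i, q i a) ^ 2
      simp_rw [CStarSeminorm.star_mul_self]
      exact (Real.iSup_pow (fun i => (q i).nonneg a) 2).symm }

theorem iSup_apply {ι : Type v} [Nonempty ι] (q : ι → CStarSeminorm 𝒜)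
    (h : ∀ a, BddAbove (Set.range fun i => q i a)) (a : 𝒜) : iSup q h a = ⨆ i, q i a := rfl

/-- The greatest C*-seminorm: the pointwise supremum of all C*-seminorms. -/
def greatest (𝒜 : Type u) [Ring 𝒜] [StarRing 𝒜] [Algebra ℂ 𝒜] [HasCStarEnvelope 𝒜] :
    CStarSeminorm 𝒜 :=
  iSup (fun q : CStarSeminorm 𝒜 => q) HasCStarEnvelope.bddAbove

/-- The C*-seminorm `a ↦ ‖φ a‖` induced by a `*`-homomorphism `φ` into a C*-algebra. -/
def ofHom {B : Type w} [CStarAlgebra B] (φ : 𝒜 →⋆ₐ[ℂ] B) : CStarSeminorm 𝒜 :=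
  { Seminorm.of (𝕜 := ℂ) (fun a => ‖φ a‖)
      (fun a b => by rw [map_add]; exact norm_add_le _ _)
      (fun c a => by rw [map_smul, norm_smul]) with
    mul_le' := fun a b => by
      change ‖φ (a * b)‖ ≤ ‖φ a‖ * ‖φ b‖
      rw [map_mul]; exact norm_mul_le _ _
    star_mul_self' := fun a => by
      change ‖φ (star a * a)‖ = ‖φ a‖ ^ 2
      rw [map_mul, map_star, CStarRing.norm_star_mul_self, pow_two] }

/-- The pullback of a C*-seminorm along a `*`-homomorphism. -/
def comp {ℬ : Type v} [Ring ℬ] [StarRing ℬ] [Algebra ℂ ℬ] (q : CStarSeminorm 𝒜)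
    (φ : ℬ →⋆ₐ[ℂ] 𝒜) : CStarSeminorm ℬ :=
  { q.toSeminorm.comp φ.toAlgHom.toLinearMap with
    mul_le' := fun a b => by
      change q (φ (a * b)) ≤ q (φ a) * q (φ b)
      rw [map_mul]; exact q.mul_le _ _
    star_mul_self' := fun a => by
      change q (φ (star a * a)) = q (φ a) ^ 2
      rw [map_mul, map_star, q.star_mul_self] }

/-- On a C*-algebra, every C*-seminorm is dominated by the norm. -/
theorem le_norm {A : Type u} [CStarAlgebra A] (q : CStarSeminorm A) (a : A) : q a ≤ ‖a‖ := by
  rw [← Completion.norm_of q a]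
  exact NonUnitalStarAlgHom.norm_apply_le (Completion.of q) a

end CStarSeminorm

/-- If the C*-seminorms are bounded on a set which generates the algebra, then they are
bounded at every element. -/
theorem HasCStarEnvelope.of_adjoin {𝒜 : Type u} [Ring 𝒜] [StarRing 𝒜] [Algebra ℂ 𝒜]
    (s : Set 𝒜) (hs : Algebra.adjoin ℂ s = ⊤)
    (h : ∀ a ∈ s, BddAbove (Set.range fun q : CStarSeminorm 𝒜 => q a)) : HasCStarEnvelope 𝒜 := by
  refine ⟨fun a => ?_⟩
  have h1 : ∀ q : CStarSeminorm 𝒜, q 1 ≤ 1 := fun q => by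
    have h2 := q.star_mul_self 1
    rw [star_one, one_mul] at h2
    nlinarith [q.nonneg 1]
  have ha : a ∈ Algebra.adjoin ℂ s := hs ▸ Algebra.mem_top
  induction ha using Algebra.adjoin_induction with
  | mem x hx => exact h x hx
  | algebraMap c =>
    refine ⟨‖c‖, ?_⟩
    rintro _ ⟨q, rfl⟩
    change q (algebraMap ℂ 𝒜 c) ≤ ‖c‖
    rw [Algebra.algebraMap_eq_smul_one, map_smul_eq_mul]
    exact mul_le_of_le_one_right (norm_nonneg c) (h1 q)
  | add x y _ _ hx hy =>
    obtain ⟨C, hC⟩ := hx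
    obtain ⟨D, hD⟩ := hy
    refine ⟨C + D, ?_⟩
    rintro _ ⟨q, rfl⟩
    exact (map_add_le_add q.toSeminorm x y).trans (add_le_add (hC ⟨q, rfl⟩) (hD ⟨q, rfl⟩))
  | mul x y _ _ hx hy =>
    obtain ⟨C, hC⟩ := hx
    obtain ⟨D, hD⟩ := hy
    refine ⟨C * D, ?_⟩
    rintro _ ⟨q, rfl⟩
    exact (q.mul_le x y).trans (mul_le_mul (hC ⟨q, rfl⟩) (hD ⟨q, rfl⟩) (q.nonneg y)
      ((q.nonneg x).trans (hC ⟨q, rfl⟩)))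

/-- The enveloping C*-algebra of a `*`-algebra: its completion with respect to the greatest
C*-seminorm. -/
abbrev CStarEnvelope (𝒜 : Type u) [Ring 𝒜] [StarRing 𝒜] [Algebra ℂ 𝒜] [HasCStarEnvelope 𝒜] :
    Type u :=
  (CStarSeminorm.greatest 𝒜).Completion

/-- The canonical map of a `*`-algebra into its enveloping C*-algebra. -/
abbrev CStarEnvelope.of (𝒜 : Type u) [Ring 𝒜] [StarRing 𝒜] [Algebra ℂ 𝒜] [StarModule ℂ 𝒜]
    [HasCStarEnvelope 𝒜] : 𝒜 →⋆ₐ[ℂ] CStarEnvelope 𝒜 :=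
  CStarSeminorm.Completion.of (CStarSeminorm.greatest 𝒜)

/-- `j : 𝒜 → A` exhibits the C*-algebra `A` as the enveloping C*-algebra of the `*`-algebra `𝒜`:
its range is dense and the norm of `A` pulls back to the supremum of all C*-seminorms of `𝒜`. -/
def IsCStarEnvelope {𝒜 : Type u} [Ring 𝒜] [StarRing 𝒜] [Algebra ℂ 𝒜] {A : Type v} [CStarAlgebra A]
    (j : 𝒜 →⋆ₐ[ℂ] A) : Prop :=
  DenseRange j ∧ ∀ a : 𝒜, IsLUB (Set.range fun q : CStarSeminorm 𝒜 => q a) ‖j a‖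

/-! ### The minimal tensor product -/

section Tensor

variable {A : Type u} {B : Type u} [CStarAlgebra A] [CStarAlgebra B]

/-- A (unital) representation of a C*-algebra on a Hilbert space. -/
structure CStarRep (A : Type u) [CStarAlgebra A] where
  /-- The Hilbert space. -/
  H : Type u
  [normed : NormedAddCommGroup H]
  [innerProduct : InnerProductSpace ℂ H]
  [complete : CompleteSpace H]
  /-- The action. -/
  π : A →⋆ₐ[ℂ] (H →L[ℂ] H)

attribute [instance] CStarRep.normed CStarRep.innerProduct CStarRep.complete

namespace CStarRep

/-- The trivial representation, on the zero Hilbert space. -/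
instance : Inhabited (CStarRep A) :=
  ⟨{ H := PUnit.{u + 1}
     π := { toFun := fun _ => 0
            map_one' := Subsingleton.elim _ _
            map_mul' := fun _ _ => Subsingleton.elim _ _
            map_zero' := rfl
            map_add' := fun _ _ => Subsingleton.elim _ _
            commutes' := fun _ => Subsingleton.elim _ _
            map_star' := fun _ => Subsingleton.elim _ _ } }⟩

/-- The pullback of a representation along a `*`-homomorphism. -/
def comp (π : CStarRep B) (f : A →⋆ₐ[ℂ] B) : CStarRep A where
  H := π.H
  π := π.π.comp f

/-- The representation `π ⊗ ρ` of the algebraic tensor product `A ⊙ B`. It acts by bounded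
operators on the algebraic tensor product of the Hilbert spaces, with its tensor product inner
product; this is a dense subspace of the Hilbert space tensor product, so that the operator
norm is the same on both. -/
def tensor (π : CStarRep A) (ρ : CStarRep B) :
    A ⊗[ℂ] B →ₐ[ℂ] (π.H ⊗[ℂ] ρ.H →L[ℂ] π.H ⊗[ℂ] ρ.H) :=
  Algebra.TensorProduct.algHomOfLinearMapTensorProduct
    (TensorProduct.lift (LinearMap.mk₂ ℂ (fun a b => TensorProduct.mapL (π.π a) (ρ.π b))
      (fun a a' b => by rw [map_add, TensorProduct.mapL_add_left])
      (fun c a b => by rw [map_smul, TensorProduct.mapL_smul_left])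
      (fun a b b' => by rw [map_add, TensorProduct.mapL_add_right])
      (fun c a b => by rw [map_smul, TensorProduct.mapL_smul_right])))
    (fun a₁ a₂ b₁ b₂ => by
      simp only [TensorProduct.lift.tmul, LinearMap.mk₂_apply, map_mul, TensorProduct.mapL_mul])
    (by
      simp only [TensorProduct.lift.tmul, LinearMap.mk₂_apply, map_one]
      exact TensorProduct.mapL_id_id)

theorem tensor_tmul (π : CStarRep A) (ρ : CStarRep B) (a : A) (b : B) :
    π.tensor ρ (a ⊗ₜ b) = TensorProduct.mapL (π.π a) (ρ.π b) := rfl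

theorem inner_tensor_star (π : CStarRep A) (ρ : CStarRep B) (x : A ⊗[ℂ] B)
    (ξ η : π.H ⊗[ℂ] ρ.H) :
    inner ℂ (π.tensor ρ (star x) ξ) η = inner ℂ ξ (π.tensor ρ x η) := by
  induction x using TensorProduct.induction_on with
  | zero => simp
  | add x y hx hy =>
    rw [star_add, map_add, map_add, _root_.add_apply, _root_.add_apply,
      inner_add_left, inner_add_right, hx, hy]
  | tmul a b =>
    rw [TensorProduct.star_tmul, tensor_tmul, tensor_tmul]
    induction ξ using TensorProduct.induction_on with
    | zero => simp
    | add x y hx hy => rw [map_add, inner_add_left, inner_add_left, hx, hy]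
    | tmul ξ₁ ξ₂ =>
      induction η using TensorProduct.induction_on with
      | zero => simp
      | add x y hx hy => rw [map_add, inner_add_right, inner_add_right, hx, hy]
      | tmul η₁ η₂ =>
        rw [TensorProduct.mapL_tmul, TensorProduct.mapL_tmul, TensorProduct.inner_tmul,
          TensorProduct.inner_tmul, map_star, map_star, ContinuousLinearMap.star_eq_adjoint,
          ContinuousLinearMap.star_eq_adjoint, ContinuousLinearMap.adjoint_inner_left,
          ContinuousLinearMap.adjoint_inner_left]

theorem norm_sq_le_of_inner {E : Type u} [NormedAddCommGroup E] [InnerProductSpace ℂ E]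
    (T S : E →L[ℂ] E) (h : ∀ ξ, inner ℂ (T ξ) (T ξ) = inner ℂ ξ (S ξ)) : ‖T‖ ^ 2 ≤ ‖S‖ := by
  refine (Real.le_sqrt (norm_nonneg _) (norm_nonneg _)).mp ?_
  refine ContinuousLinearMap.opNorm_le_bound _ (Real.sqrt_nonneg _) fun ξ => ?_
  rw [← Real.sqrt_sq (norm_nonneg ξ), ← Real.sqrt_mul (norm_nonneg _)]
  refine Real.le_sqrt_of_sq_le ?_
  rw [← inner_self_eq_norm_sq (𝕜 := ℂ), h]
  refine (RCLike.re_le_norm _).trans ((norm_inner_le_norm _ _).trans ?_)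
  have := mul_le_mul_of_nonneg_left (S.le_opNorm ξ) (norm_nonneg ξ)
  linarith

theorem norm_tensor_sq_le (π : CStarRep A) (ρ : CStarRep B) (x : A ⊗[ℂ] B) :
    ‖π.tensor ρ x‖ ^ 2 ≤ ‖π.tensor ρ (star x * x)‖ :=
  norm_sq_le_of_inner _ _ fun ξ => by
    have h := inner_tensor_star π ρ (star x) ξ (π.tensor ρ x ξ)
    rw [star_star] at h
    refine h.trans ?_
    rw [map_mul]
    rfl

/-- The C*-seminorm `x ↦ ‖(π ⊗ ρ) x‖` on the algebraic tensor product `A ⊙ B`. -/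
def tensorSeminorm (π : CStarRep A) (ρ : CStarRep B) : CStarSeminorm (A ⊗[ℂ] B) :=
  have hmul : ∀ a b, ‖π.tensor ρ (a * b)‖ ≤ ‖π.tensor ρ a‖ * ‖π.tensor ρ b‖ := fun a b => by
    rw [map_mul]; exact ContinuousLinearMap.opNorm_comp_le _ _
  have hle : ∀ x, ‖π.tensor ρ x‖ ≤ ‖π.tensor ρ (star x)‖ := fun x => by
    have h := (norm_tensor_sq_le π ρ x).trans (hmul (star x) x)
    have h1 : 0 ≤ ‖π.tensor ρ x‖ := ContinuousLinearMap.opNorm_nonneg _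
    have h2 : 0 ≤ ‖π.tensor ρ (star x)‖ := ContinuousLinearMap.opNorm_nonneg _
    nlinarith
  { Seminorm.ofSMulLE (𝕜 := ℂ) (fun x => ‖π.tensor ρ x‖)
      (by rw [map_zero]; exact ContinuousLinearMap.opNorm_zero)
      (fun a b => by rw [map_add]; exact ContinuousLinearMap.opNorm_add_le _ _)
      (fun c a => by rw [map_smul]; exact ContinuousLinearMap.opNorm_smul_le _ _) with
    mul_le' := hmul
    star_mul_self' := fun a => by
      change ‖π.tensor ρ (star a * a)‖ = ‖π.tensor ρ a‖ ^ 2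
      refine le_antisymm ?_ (norm_tensor_sq_le π ρ a)
      rw [pow_two]
      refine (hmul _ _).trans (mul_le_mul_of_nonneg_right ?_ (ContinuousLinearMap.opNorm_nonneg _))
      simpa using hle (star a) }

end CStarRep

theorem bddAbove_tensorSeminorm (x : A ⊗[ℂ] B) :
    BddAbove (Set.range fun p : CStarRep A × CStarRep B => p.1.tensorSeminorm p.2 x) := by
  induction x using TensorProduct.induction_on with
  | zero =>
    refine ⟨0, ?_⟩
    rintro _ ⟨p, rfl⟩
    exact (map_zero (p.1.tensorSeminorm p.2).toSeminorm).le
  | add x y hx hy =>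
    obtain ⟨C, hC⟩ := hx
    obtain ⟨D, hD⟩ := hy
    refine ⟨C + D, ?_⟩
    rintro _ ⟨p, rfl⟩
    exact (map_add_le_add (p.1.tensorSeminorm p.2).toSeminorm x y).trans
      (add_le_add (hC ⟨p, rfl⟩) (hD ⟨p, rfl⟩))
  | tmul a b =>
    refine ⟨‖a‖ * ‖b‖, ?_⟩
    rintro _ ⟨p, rfl⟩
    change ‖TensorProduct.mapL (p.1.π a) (p.2.π b)‖ ≤ ‖a‖ * ‖b‖
    exact (TensorProduct.norm_mapL_le _ _).trans (mul_le_mul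
      (NonUnitalStarAlgHom.norm_apply_le p.1.π a) (NonUnitalStarAlgHom.norm_apply_le p.2.π b)
      (norm_nonneg _) (norm_nonneg _))

variable (A B) in
/-- The minimal (spatial) C*-norm on the algebraic tensor product:
`‖x‖_min = sup ‖(π ⊗ ρ) x‖` over all representations `π` of `A` and `ρ` of `B`. -/
def minTensorNorm : CStarSeminorm (A ⊗[ℂ] B) :=
  CStarSeminorm.iSup (fun p : CStarRep A × CStarRep B => p.1.tensorSeminorm p.2)
    bddAbove_tensorSeminorm

variable (A B) in
/-- The minimal tensor product of two unital C*-algebras. -/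
abbrev MinTensor : Type u := (minTensorNorm A B).Completion

namespace MinTensor

/-- The elementary tensor `a ⊗ b` in the minimal tensor product. -/
def tmul (a : A) (b : B) : MinTensor A B := CStarSeminorm.Completion.of _ (a ⊗ₜ[ℂ] b)

variable {C D : Type u} [CStarAlgebra C] [CStarAlgebra D]

/-- The `*`-homomorphism `f ⊗ g` between the algebraic tensor products. -/
def algMap (f : A →⋆ₐ[ℂ] C) (g : B →⋆ₐ[ℂ] D) : A ⊗[ℂ] B →⋆ₐ[ℂ] C ⊗[ℂ] D :=
  { Algebra.TensorProduct.map f.toAlgHom g.toAlgHom with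
    map_star' := fun x => by
      change Algebra.TensorProduct.map f.toAlgHom g.toAlgHom (star x) =
        star (Algebra.TensorProduct.map f.toAlgHom g.toAlgHom x)
      induction x using TensorProduct.induction_on with
      | zero => simp
      | add x y hx hy => rw [star_add, map_add, map_add, star_add, hx, hy]
      | tmul a b =>
        rw [TensorProduct.star_tmul, Algebra.TensorProduct.map_tmul,
          Algebra.TensorProduct.map_tmul, TensorProduct.star_tmul]
        exact congrArg₂ _ (map_star f a) (map_star g b) }

theorem algMap_le (f : A →⋆ₐ[ℂ] C) (g : B →⋆ₐ[ℂ] D) (x : A ⊗[ℂ] B) :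
    minTensorNorm C D (algMap f g x) ≤ minTensorNorm A B x := by
  refine ciSup_le fun p => ?_
  have h : ((p.1.comp f).tensor (p.2.comp g)).toLinearMap =
      (p.1.tensor p.2).toLinearMap ∘ₗ (algMap f g).toAlgHom.toLinearMap :=
    TensorProduct.ext' fun a b => rfl
  have h' : p.1.tensorSeminorm p.2 (algMap f g x) =
      (p.1.comp f).tensorSeminorm (p.2.comp g) x :=
    congrArg norm (LinearMap.congr_fun h x).symm
  rw [h']
  exact le_ciSup (bddAbove_tensorSeminorm x) (p.1.comp f, p.2.comp g)

/-- The `*`-homomorphism `f ⊗ g` between minimal tensor products, with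
`(f ⊗ g) (a ⊗ b) = f a ⊗ g b`. -/
def map (f : A →⋆ₐ[ℂ] C) (g : B →⋆ₐ[ℂ] D) : MinTensor A B →⋆ₐ[ℂ] MinTensor C D :=
  CStarSeminorm.Completion.lift ((CStarSeminorm.Completion.of (minTensorNorm C D)).comp (algMap f g))
    (fun x => (CStarSeminorm.Completion.norm_of _ _).trans_le (algMap_le f g x))

theorem map_tmul (f : A →⋆ₐ[ℂ] C) (g : B →⋆ₐ[ℂ] D) (a : A) (b : B) :
    map f g (tmul a b) = tmul (f a) (g b) :=
  CStarSeminorm.Completion.lift_of _ _ _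

end MinTensor

end Tensor

/-! ### Involutions on algebras given by universal properties -/

/-- The conjugate opposite of a complex algebra: opposite multiplication, and scalars act
through complex conjugation. An involution is the same as an involutive algebra homomorphism into
the conjugate opposite. -/
def ConjOp (F : Type u) : Type u := Fᵐᵒᵖ

namespace ConjOp

variable {F : Type u} [Ring F]

instance : Ring (ConjOp F) := inferInstanceAs (Ring Fᵐᵒᵖ)

/-- The identity map from `F` to its conjugate opposite. -/
def op (x : F) : ConjOp F := MulOpposite.op x

/-- The identity map to `F` from its conjugate opposite. -/
def unop (x : ConjOp F) : F := MulOpposite.unop x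

theorem op_mul (x y : F) : op (x * y) = op y * op x := rfl
theorem op_add (x y : F) : op (x + y) = op x + op y := rfl
theorem op_one : op (1 : F) = 1 := rfl
theorem op_sum {ι : Type v} (s : Finset ι) (f : ι → F) : op (∑ i ∈ s, f i) = ∑ i ∈ s, op (f i) :=
  map_sum (MulOpposite.opAddEquiv : F ≃+ Fᵐᵒᵖ) f s
theorem unop_mul (x y : ConjOp F) : unop (x * y) = unop y * unop x := rfl
theorem unop_add (x y : ConjOp F) : unop (x + y) = unop x + unop y := rfl

variable [Algebra ℂ F]

instance : Algebra ℂ (ConjOp F) :=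
  RingHom.toAlgebra' ((algebraMap ℂ Fᵐᵒᵖ).comp (starRingEnd ℂ)) fun c x =>
    Algebra.commutes (A := Fᵐᵒᵖ) (starRingEnd ℂ c) x

theorem smul_def (c : ℂ) (x : ConjOp F) : c • x = op (star c • unop x) := by
  rw [Algebra.smul_def]
  exact congrArg MulOpposite.op
    ((Algebra.commutes (star c) (unop x)).symm.trans (Algebra.smul_def _ _).symm)

variable (s : F →ₐ[ℂ] ConjOp F)

/-- The square of a homomorphism into the conjugate opposite, as an algebra endomorphism. -/
def square : F →ₐ[ℂ] F where
  toFun x := unop (s (unop (s x)))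
  map_one' := by
    have h : unop (s 1) = 1 := by rw [map_one]; rfl
    rw [h, h]
  map_mul' x y := by rw [map_mul, unop_mul, map_mul, unop_mul]
  map_zero' := by
    have h : unop (s 0) = 0 := by rw [map_zero]; rfl
    rw [h, h]
  map_add' x y := by rw [map_add, unop_add, map_add, unop_add]
  commutes' c := by
    have h : ∀ c : ℂ, unop (s (algebraMap ℂ F c)) = algebraMap ℂ F (star c) := fun c => by
      rw [AlgHom.commutes]; rfl
    rw [h, h, star_star]

/-- The `*`-ring structure given by a homomorphism into the conjugate opposite whose square is
the identity. -/
@[reducible]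
def starRing (hs : square s = AlgHom.id ℂ F) : StarRing F where
  star x := unop (s x)
  star_involutive x := DFunLike.congr_fun hs x
  star_mul x y := by
    change unop (s (x * y)) = unop (s y) * unop (s x)
    rw [map_mul]; rfl
  star_add x y := by
    change unop (s (x + y)) = unop (s x) + unop (s y)
    rw [map_add]; rfl

theorem starModule (hs : square s = AlgHom.id ℂ F) :
    letI := starRing s hs
    StarModule ℂ F :=
  letI := starRing s hs
  { star_smul := fun c x => by
      change unop (s (c • x)) = star c • unop (s x)
      rw [map_smul, smul_def]; rfl }

end ConjOp

/-! ### Free products -/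

section FreeProduct

variable {I : Type v} [DecidableEq I] (A : I → Type u)

section Alg

variable [∀ i, Ring (A i)] [∀ i, Algebra ℂ (A i)]

/-- The algebraic free product (coproduct of unital algebras) of a family of complex algebras. -/
def AlgFreeProduct : Type (max u v) := LinearAlgebra.FreeProduct ℂ A

namespace AlgFreeProduct

instance : Ring (AlgFreeProduct A) := inferInstanceAs (Ring (LinearAlgebra.FreeProduct ℂ A))
instance : Algebra ℂ (AlgFreeProduct A) :=
  inferInstanceAs (Algebra ℂ (LinearAlgebra.FreeProduct ℂ A))

/-- The canonical homomorphisms into the free product. -/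
def ι (i : I) : A i →ₐ[ℂ] AlgFreeProduct A := LinearAlgebra.FreeProduct.ι ℂ A i

variable {A}

/-- The universal property of the free product. -/
def lift {B : Type w} [Ring B] [Algebra ℂ B] (f : ∀ i, A i →ₐ[ℂ] B) : AlgFreeProduct A →ₐ[ℂ] B :=
  LinearAlgebra.FreeProduct.lift ℂ A (fun {i} => f i)

theorem lift_ι {B : Type w} [Ring B] [Algebra ℂ B] (f : ∀ i, A i →ₐ[ℂ] B) (i : I) (a : A i) :
    lift f (ι A i a) = f i a :=
  DFunLike.congr_fun (LinearAlgebra.FreeProduct.lift_comp_ι ℂ A (fun {i} => f i)) a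

theorem hom_ext {B : Type w} [Ring B] [Algebra ℂ B] {f g : AlgFreeProduct A →ₐ[ℂ] B}
    (h : ∀ i a, f (ι A i a) = g (ι A i a)) : f = g := by
  have hf := LinearAlgebra.FreeProduct.lift_unique ℂ A (fun {i} => f.comp (ι A i)) f
    (fun i => rfl)
  have hg := LinearAlgebra.FreeProduct.lift_unique ℂ A (fun {i} => f.comp (ι A i)) g
    (fun i => AlgHom.ext fun a => (h i a).symm)
  exact hf.trans hg.symm

theorem adjoin_range : Algebra.adjoin ℂ (⋃ i, Set.range (ι A i)) = ⊤ := by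
  set S := Algebra.adjoin ℂ (⋃ i, Set.range (ι A i))
  have hS : ∀ i a, ι A i a ∈ S := fun i a =>
    Algebra.subset_adjoin (Set.mem_iUnion.mpr ⟨i, a, rfl⟩)
  let f : AlgFreeProduct A →ₐ[ℂ] S := lift fun i => (ι A i).codRestrict S (hS i)
  have h : S.val.comp f = AlgHom.id ℂ _ := hom_ext fun i a => by
    rw [AlgHom.comp_apply, lift_ι]; rfl
  refine eq_top_iff.mpr fun x _ => ?_
  have := DFunLike.congr_fun h x
  rw [AlgHom.comp_apply, AlgHom.id_apply] at this
  rw [← this]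
  exact (f x).2

variable [∀ i, StarRing (A i)] [∀ i, StarModule ℂ (A i)]

/-- The involution of the free product, as a homomorphism into the conjugate opposite. -/
def starHom : AlgFreeProduct A →ₐ[ℂ] ConjOp (AlgFreeProduct A) :=
  lift fun i =>
    { toFun := fun a => ConjOp.op (ι A i (star a))
      map_one' := by rw [star_one, map_one]; rfl
      map_mul' := fun a b => by rw [star_mul, map_mul]; rfl
      map_zero' := by rw [star_zero, map_zero]; rfl
      map_add' := fun a b => by rw [star_add, map_add]; rfl
      commutes' := fun c => by
        rw [← algebraMap_star_comm, AlgHom.commutes]; rfl }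

theorem starHom_ι (i : I) (a : A i) : starHom (ι A i a) = ConjOp.op (ι A i (star a)) := lift_ι _ i a

theorem square_starHom : ConjOp.square (starHom (A := A)) = AlgHom.id ℂ _ := hom_ext fun i a => by
  change ConjOp.unop (starHom (ConjOp.unop (starHom (ι A i a)))) = ι A i a
  rw [starHom_ι]
  change ConjOp.unop (starHom (ι A i (star a))) = ι A i a
  rw [starHom_ι, star_star]
  rfl

instance : StarRing (AlgFreeProduct A) := ConjOp.starRing starHom square_starHom
instance : StarModule ℂ (AlgFreeProduct A) := ConjOp.starModule starHom square_starHom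

variable (A) in
/-- The canonical `*`-homomorphisms into the free product of `*`-algebras. -/
def ιStar (i : I) : A i →⋆ₐ[ℂ] AlgFreeProduct A :=
  { ι A i with
    map_star' := fun a => (congrArg ConjOp.unop (starHom_ι i a)).symm }

end AlgFreeProduct

end Alg

variable [∀ i, CStarAlgebra (A i)]

instance : HasCStarEnvelope (AlgFreeProduct A) :=
  HasCStarEnvelope.of_adjoin _ AlgFreeProduct.adjoin_range fun x hx => by
    obtain ⟨i, a, rfl⟩ := Set.mem_iUnion.mp hx
    refine ⟨‖a‖, ?_⟩
    rintro _ ⟨q, rfl⟩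
    exact (q.comp (AlgFreeProduct.ιStar A i)).le_norm a

/-- The free product C*-algebra (coproduct of unital C*-algebras) of a family: the enveloping
C*-algebra of the algebraic free product. -/
abbrev CStarFreeProduct : Type (max u v) := CStarEnvelope (AlgFreeProduct A)

/-- The canonical `*`-homomorphisms into the free product C*-algebra. -/
def CStarFreeProduct.ι (i : I) : A i →⋆ₐ[ℂ] CStarFreeProduct A :=
  (CStarEnvelope.of (AlgFreeProduct A)).comp (AlgFreeProduct.ιStar A i)

end FreeProduct

/-- The family consisting of two types. -/
def PairFamily (A B : Type u) : Bool → Type u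
  | false => A
  | true => B

instance (A B : Type u) [CStarAlgebra A] [CStarAlgebra B] : ∀ b, CStarAlgebra (PairFamily A B b)
  | false => inferInstanceAs (CStarAlgebra A)
  | true => inferInstanceAs (CStarAlgebra B)

/-- The free product C*-algebra `A * B` of two unital C*-algebras. -/
abbrev CStarFreeProduct₂ (A B : Type u) [CStarAlgebra A] [CStarAlgebra B] : Type u :=
  CStarFreeProduct (PairFamily A B)

namespace CStarFreeProduct₂

variable (A B : Type u) [CStarAlgebra A] [CStarAlgebra B]

/-- The canonical map of the first factor. -/
def inl : A →⋆ₐ[ℂ] CStarFreeProduct₂ A B := CStarFreeProduct.ι (PairFamily A B) false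

/-- The canonical map of the second factor. -/
def inr : B →⋆ₐ[ℂ] CStarFreeProduct₂ A B := CStarFreeProduct.ι (PairFamily A B) true

end CStarFreeProduct₂

/-! ### The quantum permutation group -/

/-- The defining relations of `𝒜_t(n)`. The index set of the generators is lifted to an arbitrary
universe. -/
inductive QPermRel (n : ℕ) : FreeAlgebra ℂ (ULift.{u} (Fin n × Fin n)) →
    FreeAlgebra ℂ (ULift.{u} (Fin n × Fin n)) → Prop
  | row_mul (i j k : Fin n) :
      QPermRel n (FreeAlgebra.ι ℂ ⟨(i, j)⟩ * FreeAlgebra.ι ℂ ⟨(i, k)⟩)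
        (if j = k then FreeAlgebra.ι ℂ ⟨(i, j)⟩ else 0)
  | col_mul (i j k : Fin n) :
      QPermRel n (FreeAlgebra.ι ℂ ⟨(j, i)⟩ * FreeAlgebra.ι ℂ ⟨(k, i)⟩)
        (if j = k then FreeAlgebra.ι ℂ ⟨(j, i)⟩ else 0)
  | row_sum (i : Fin n) : QPermRel n (∑ l, FreeAlgebra.ι ℂ ⟨(i, l)⟩) 1
  | col_sum (i : Fin n) : QPermRel n (∑ l, FreeAlgebra.ι ℂ ⟨(l, i)⟩) 1

/-- The algebra `𝒜_t(n)`: the universal complex algebra with generators `x i j` and the relations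
`x i j * x i k = δ_{jk} x i j`, `x j i * x k i = δ_{jk} x j i`, `∑ l, x i l = 1 = ∑ l, x l i`. -/
def QPermAlg (n : ℕ) : Type u := RingQuot (QPermRel.{u} n)

namespace QPermAlg

variable (n : ℕ)

instance : Ring (QPermAlg.{u} n) := inferInstanceAs (Ring (RingQuot (QPermRel.{u} n)))
instance : Algebra ℂ (QPermAlg.{u} n) := inferInstanceAs (Algebra ℂ (RingQuot (QPermRel.{u} n)))

/-- The quotient map from the free algebra. -/
def mk : FreeAlgebra ℂ (ULift.{u} (Fin n × Fin n)) →ₐ[ℂ] QPermAlg.{u} n :=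
  RingQuot.mkAlgHom ℂ (QPermRel.{u} n)

variable {n}

/-- The generators of `𝒜_t(n)`. -/
def x (i j : Fin n) : QPermAlg.{u} n := mk n (FreeAlgebra.ι ℂ ⟨(i, j)⟩)

theorem x_mul_row (i j k : Fin n) :
    (x i j * x i k : QPermAlg.{u} n) = if j = k then x i j else 0 := by
  have h := RingQuot.mkAlgHom_rel ℂ (QPermRel.row_mul.{u} i j k)
  rw [map_mul] at h
  refine h.trans ?_
  split_ifs
  · rfl
  · exact map_zero _

theorem x_mul_col (i j k : Fin n) :
    (x j i * x k i : QPermAlg.{u} n) = if j = k then x j i else 0 := by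
  have h := RingQuot.mkAlgHom_rel ℂ (QPermRel.col_mul.{u} i j k)
  rw [map_mul] at h
  refine h.trans ?_
  split_ifs
  · rfl
  · exact map_zero _

theorem sum_row (i : Fin n) : (∑ l, x i l : QPermAlg.{u} n) = 1 := by
  have h := RingQuot.mkAlgHom_rel ℂ (QPermRel.row_sum.{u} i)
  rw [map_sum, map_one] at h
  exact h

theorem sum_col (i : Fin n) : (∑ l, x l i : QPermAlg.{u} n) = 1 := by
  have h := RingQuot.mkAlgHom_rel ℂ (QPermRel.col_sum.{u} i)
  rw [map_sum, map_one] at h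
  exact h

theorem hom_ext {B : Type w} [Ring B] [Algebra ℂ B] {f g : QPermAlg.{u} n →ₐ[ℂ] B}
    (h : ∀ i j, f (x i j) = g (x i j)) : f = g := by
  refine RingQuot.ringQuot_ext' ℂ f g (FreeAlgebra.hom_ext ?_)
  funext p
  exact h p.down.1 p.down.2

theorem adjoin_range : Algebra.adjoin ℂ (Set.range fun p : Fin n × Fin n => x.{u} p.1 p.2) = ⊤ := by
  refine eq_top_iff.mpr fun a _ => ?_
  obtain ⟨b, rfl⟩ := RingQuot.mkAlgHom_surjective ℂ (QPermRel.{u} n) a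
  induction b using FreeAlgebra.induction with
  | grade0 c => 
    rw [AlgHom.commutes]
    exact Subalgebra.algebraMap_mem _ c
  | grade1 p => exact Algebra.subset_adjoin ⟨p.down, rfl⟩
  | mul a b ha hb => rw [map_mul]; exact mul_mem (ha trivial) (hb trivial)
  | add a b ha hb => rw [map_add]; exact add_mem (ha trivial) (hb trivial)

/-- The involution of `𝒜_t(n)`, as a homomorphism into the conjugate opposite. -/
def starHom (n : ℕ) : QPermAlg.{u} n →ₐ[ℂ] ConjOp (QPermAlg.{u} n) :=
  RingQuot.liftAlgHom ℂ ⟨FreeAlgebra.lift ℂ fun p => ConjOp.op (x p.down.1 p.down.2), by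
    intro a b hab
    cases hab with
    | row_mul i j k =>
      rw [map_mul, FreeAlgebra.lift_ι_apply, FreeAlgebra.lift_ι_apply, ← ConjOp.op_mul, x_mul_row]
      by_cases h : j = k
      · subst h; rw [if_pos rfl, if_pos rfl, FreeAlgebra.lift_ι_apply]
      · rw [if_neg h, if_neg (Ne.symm h), map_zero]; rfl
    | col_mul i j k =>
      rw [map_mul, FreeAlgebra.lift_ι_apply, FreeAlgebra.lift_ι_apply, ← ConjOp.op_mul, x_mul_col]
      by_cases h : j = k
      · subst h; rw [if_pos rfl, if_pos rfl, FreeAlgebra.lift_ι_apply]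
      · rw [if_neg h, if_neg (Ne.symm h), map_zero]; rfl
    | row_sum i =>
      rw [map_sum, map_one]
      simp only [FreeAlgebra.lift_ι_apply]
      rw [← ConjOp.op_sum, sum_row]; rfl
    | col_sum i =>
      rw [map_sum, map_one]
      simp only [FreeAlgebra.lift_ι_apply]
      rw [← ConjOp.op_sum, sum_col]; rfl⟩

theorem starHom_x (i j : Fin n) : starHom.{u} n (x i j) = ConjOp.op (x i j) :=
  (RingQuot.liftAlgHom_mkAlgHom_apply ℂ _ _ _).trans (FreeAlgebra.lift_ι_apply _ _)

theorem square_starHom : ConjOp.square (starHom.{u} n) = AlgHom.id ℂ _ := hom_ext fun i j => by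
  change ConjOp.unop (starHom.{u} n (ConjOp.unop (starHom.{u} n (x i j)))) = x i j
  rw [starHom_x]
  change ConjOp.unop (starHom.{u} n (x i j)) = x i j
  rw [starHom_x]
  rfl

/-- The `*`-algebra structure of `𝒜_t(n)`, with `star (x i j) = x i j`. -/
instance : StarRing (QPermAlg.{u} n) := ConjOp.starRing (starHom n) square_starHom
instance : StarModule ℂ (QPermAlg.{u} n) := ConjOp.starModule (starHom n) square_starHom

theorem star_x (i j : Fin n) : star (x.{u} i j) = x i j :=
  congrArg ConjOp.unop (starHom_x i j)

instance : HasCStarEnvelope (QPermAlg.{u} n) :=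
  HasCStarEnvelope.of_adjoin _ adjoin_range fun a ha => by
    obtain ⟨p, rfl⟩ := ha
    refine ⟨1, ?_⟩
    rintro _ ⟨q, rfl⟩
    have h := q.star_mul_self (x p.1 p.2)
    rw [star_x, x_mul_row, if_pos rfl] at h
    have h0 := q.nonneg (x p.1 p.2)
    change q (x p.1 p.2) ≤ 1
    nlinarith

end QPermAlg

/-- The C*-algebra `A_aut(X_n)` of the quantum permutation group: the enveloping C*-algebra of
`𝒜_t(n)`. -/
abbrev QPerm (n : ℕ) : Type u := CStarEnvelope (QPermAlg.{u} n)

/-- The generators `x i j` of `A_aut(X_n)`. -/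
def QPerm.x {n : ℕ} (i j : Fin n) : QPerm.{u} n := CStarEnvelope.of (QPermAlg.{u} n) (QPermAlg.x i j)

/-! ### Quotients of C*-algebras -/

section Quotient

variable {A : Type u} [CStarAlgebra A]

namespace ClosedIdeal

variable (I : Ideal A)

theorem smul_mem (c : ℂ) {x : A} (hx : x ∈ I) : c • x ∈ I := by
  rw [Algebra.smul_def]
  exact I.mul_mem_left _ hx

/-- The self-adjoint part `I ∩ I*` of an ideal. -/
def selfAdjointPart : NonUnitalStarSubalgebra ℂ A where
  carrier := {x | x ∈ I ∧ star x ∈ I}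
  add_mem' := fun ha hb => ⟨I.add_mem ha.1 hb.1, by rw [star_add]; exact I.add_mem ha.2 hb.2⟩
  zero_mem' := ⟨I.zero_mem, by rw [star_zero]; exact I.zero_mem⟩
  mul_mem' := fun {a b} ha hb => ⟨I.mul_mem_left _ hb.1, by
    rw [star_mul]; exact I.mul_mem_left _ ha.2⟩
  smul_mem' := fun c x hx => ⟨smul_mem I c hx.1, by rw [star_smul]; exact smul_mem I _ hx.2⟩
  star_mem' := fun {a} ha => ⟨ha.2, by rw [star_star]; exact ha.1⟩

variable [hI : IsClosed (I : Set A)]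

theorem isClosed_selfAdjointPart : IsClosed (selfAdjointPart I : Set A) :=
  hI.inter (hI.preimage continuous_star)

/-- Approximate units in a closed ideal. -/
theorem exists_approx {y : A} (hy : y ∈ I) (hy' : star y ∈ I) {ε : ℝ} (hε : 0 < ε) :
    ∃ e ∈ I, star e = e ∧ ‖1 - e‖ ≤ 1 ∧ ‖y * (1 - e)‖ < ε := by
  have := isClosed_selfAdjointPart I
  let : NonUnitalCStarAlgebra (selfAdjointPart I) :=
    NonUnitalStarSubalgebra.nonUnitalCStarAlgebra (selfAdjointPart I)
  let := CStarAlgebra.spectralOrder (selfAdjointPart I)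
  let := CStarAlgebra.spectralOrderedRing (selfAdjointPart I)
  let := CStarAlgebra.spectralOrder A
  let := CStarAlgebra.spectralOrderedRing A
  have hu := CStarAlgebra.increasingApproximateUnit (selfAdjointPart I)
  have h1 := hu.tendsto_mul_left ⟨y, hy, hy'⟩
  have h2 := (Metric.tendsto_nhds.mp h1) ε hε
  obtain ⟨e, he1, he2, he3⟩ := (h2.and (hu.eventually_nonneg.and hu.eventually_norm)).exists
  obtain ⟨s, hs⟩ := CStarAlgebra.nonneg_iff_eq_star_mul_self.mp he2
  have hs' : (e : A) = star (s : A) * (s : A) := congrArg Subtype.val hs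
  have he : (0 : A) ≤ (e : A) := hs' ▸ star_mul_self_nonneg _
  have hle : (e : A) ≤ 1 := (CStarAlgebra.norm_le_one_iff_of_nonneg (e : A) he).mp he3
  refine ⟨e, e.2.1, (IsSelfAdjoint.of_nonneg he).star_eq, ?_, ?_⟩
  · exact (CStarAlgebra.norm_le_one_iff_of_nonneg (1 - (e : A)) (sub_nonneg.mpr hle)).mpr
      (sub_le_self _ he)
  · rw [dist_eq_norm] at he1
    have h3 : ‖y * (e : A) - y‖ < ε := he1
    rwa [mul_sub, mul_one, norm_sub_rev]

theorem norm_mul_one_sub_sq {x e : A} (he : star e = e) :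
    ‖x * (1 - e)‖ * ‖x * (1 - e)‖ = ‖(1 - e) * (star x * x * (1 - e))‖ := by
  rw [← CStarRing.norm_star_mul_self, star_mul, star_sub, star_one, he]
  simp only [mul_assoc]

theorem star_mem [I.IsTwoSided] {x : A} (hx : x ∈ I) : star x ∈ I := by
  have hy : star x * x ∈ I := I.mul_mem_left _ hx
  refine hI.closure_subset_iff.mpr subset_rfl (Metric.mem_closure_iff.mpr fun ε hε => ?_)
  obtain ⟨e, heI, he, he', h⟩ := exists_approx I hy (by simpa using hy) (mul_pos hε hε)
  refine ⟨e * star x, I.mul_mem_right _ heI, ?_⟩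
  have h1 : dist (star x) (e * star x) = ‖x * (1 - e)‖ := by
    rw [dist_eq_norm, ← norm_star (x * (1 - e)), star_mul, star_sub, star_one, he, sub_mul, one_mul]
  rw [h1]
  refine lt_of_mul_self_lt_mul_self₀ hε.le ?_
  rw [norm_mul_one_sub_sq he]
  refine ((norm_mul_le _ _).trans ?_).trans_lt h
  exact mul_le_of_le_one_left (norm_nonneg _) he'

end ClosedIdeal

/-- The quotient C*-algebra `A / I` of a C*-algebra by a closed two-sided ideal, with the
quotient norm. -/
def CStarQuotient (I : Ideal A) [I.IsTwoSided] [IsClosed (I : Set A)] : Type u := A ⧸ I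

namespace CStarQuotient

variable (I : Ideal A) [I.IsTwoSided] [hI : IsClosed (I : Set A)]

instance : Ring (CStarQuotient I) := inferInstanceAs (Ring (A ⧸ I))

/-- The quotient map, as a ring homomorphism. -/
def mkRingHom : A →+* CStarQuotient I := Ideal.Quotient.mk I

theorem mkRingHom_surjective : Function.Surjective (mkRingHom I) := Ideal.Quotient.mk_surjective

theorem mkRingHom_eq {x y : A} : mkRingHom I x = mkRingHom I y ↔ x - y ∈ I := Ideal.Quotient.eq

instance : Algebra ℂ (CStarQuotient I) :=
  ((mkRingHom I).comp (algebraMap ℂ A)).toAlgebra' fun c x => by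
    obtain ⟨x, rfl⟩ := mkRingHom_surjective I x
    rw [RingHom.comp_apply, ← map_mul, ← map_mul, Algebra.commutes]

theorem mk_smul (c : ℂ) (x : A) : mkRingHom I (c • x) = c • mkRingHom I x := by
  rw [Algebra.smul_def, Algebra.smul_def, map_mul]; rfl

instance : Norm (CStarQuotient I) := (Submodule.Quotient.normedAddCommGroup I).toNorm

instance : MetricSpace (CStarQuotient I) := (Submodule.Quotient.normedAddCommGroup I).toMetricSpace

theorem norm_mk_le (x : A) : ‖mkRingHom I x‖ ≤ ‖x‖ := Submodule.Quotient.norm_mk_le I x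

theorem exists_norm_lt (x : CStarQuotient I) {ε : ℝ} (hε : 0 < ε) :
    ∃ a : A, mkRingHom I a = x ∧ ‖a‖ < ‖x‖ + ε := Submodule.Quotient.norm_mk_lt (S := I) x hε

instance : NormedRing (CStarQuotient I) where
  dist_eq := (Submodule.Quotient.normedAddCommGroup I).dist_eq
  norm_mul_le x y := by
    have h : ∀ ε : ℝ, 0 < ε → ‖x * y‖ ≤ (‖x‖ + ε) * (‖y‖ + ε) := fun ε hε => by
      obtain ⟨a, rfl, ha⟩ := exists_norm_lt I x hε
      obtain ⟨b, rfl, hb⟩ := exists_norm_lt I y hε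
      rw [← map_mul]
      exact (norm_mk_le I _).trans ((norm_mul_le a b).trans (mul_le_mul ha.le hb.le
        (norm_nonneg b) ((norm_nonneg a).trans ha.le)))
    have hc : Filter.Tendsto (fun ε : ℝ => (‖x‖ + ε) * (‖y‖ + ε)) (nhdsWithin 0 (Set.Ioi 0))
        (nhds ((‖x‖ + 0) * (‖y‖ + 0))) :=
      ((by fun_prop : Continuous fun ε : ℝ => (‖x‖ + ε) * (‖y‖ + ε)).tendsto 0).mono_left
        nhdsWithin_le_nhds
    simp only [add_zero] at hc
    exact ge_of_tendsto hc (Filter.eventually_of_mem self_mem_nhdsWithin h)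

instance : CompleteSpace (CStarQuotient I) := Submodule.Quotient.completeSpace I

instance : NormedAlgebra ℂ (CStarQuotient I) where
  norm_smul_le c x := by
    have h : ∀ ε : ℝ, 0 < ε → ‖c • x‖ ≤ ‖c‖ * (‖x‖ + ε) := fun ε hε => by
      obtain ⟨a, rfl, ha⟩ := exists_norm_lt I x hε
      rw [← mk_smul]
      exact (norm_mk_le I _).trans ((norm_smul_le c a).trans
        (mul_le_mul_of_nonneg_left ha.le (norm_nonneg c)))
    have hc : Filter.Tendsto (fun ε : ℝ => ‖c‖ * (‖x‖ + ε)) (nhdsWithin 0 (Set.Ioi 0))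
        (nhds (‖c‖ * (‖x‖ + 0))) :=
      ((by fun_prop : Continuous fun ε : ℝ => ‖c‖ * (‖x‖ + ε)).tendsto 0).mono_left
        nhdsWithin_le_nhds
    simp only [add_zero] at hc
    exact ge_of_tendsto hc (Filter.eventually_of_mem self_mem_nhdsWithin h)

instance : Star (CStarQuotient I) :=
  ⟨Quotient.map' star fun a b h => by
    rw [Submodule.quotientRel_def] at h ⊢
    rw [← star_sub]
    exact ClosedIdeal.star_mem I h⟩

theorem mk_star (x : A) : mkRingHom I (star x) = star (mkRingHom I x) := rfl

instance : StarRing (CStarQuotient I) where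
  star_involutive x := by
    obtain ⟨x, rfl⟩ := mkRingHom_surjective I x
    rw [← mk_star, ← mk_star, star_star]
  star_mul x y := by
    obtain ⟨x, rfl⟩ := mkRingHom_surjective I x
    obtain ⟨y, rfl⟩ := mkRingHom_surjective I y
    rw [← map_mul, ← mk_star, ← mk_star, ← mk_star, star_mul, map_mul]
  star_add x y := by
    obtain ⟨x, rfl⟩ := mkRingHom_surjective I x
    obtain ⟨y, rfl⟩ := mkRingHom_surjective I y
    rw [← map_add, ← mk_star, ← mk_star, ← mk_star, star_add, map_add]

instance : StarModule ℂ (CStarQuotient I) where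
  star_smul c x := by
    obtain ⟨x, rfl⟩ := mkRingHom_surjective I x
    rw [← mk_smul, ← mk_star, ← mk_star, star_smul, mk_smul]

theorem mk_eq_of_mem {x e : A} (he : e ∈ I) : mkRingHom I x = mkRingHom I (x * (1 - e)) := by
  rw [mkRingHom_eq, mul_sub, mul_one, sub_sub_cancel]
  exact I.mul_mem_left _ he

instance : CStarRing (CStarQuotient I) where
  norm_mul_self_le x := by
    refine le_of_forall_pos_le_add fun ε hε => ?_
    obtain ⟨x, rfl⟩ := mkRingHom_surjective I x
    rw [← mk_star, ← map_mul]
    obtain ⟨z, hz, hz'⟩ := exists_norm_lt I (mkRingHom I (star x * x)) (half_pos hε)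
    have hj : star x * x - z ∈ I := (mkRingHom_eq I).mp hz.symm
    obtain ⟨e, heI, he, he', h⟩ := ClosedIdeal.exists_approx I hj (ClosedIdeal.star_mem I hj)
      (half_pos hε)
    rw [mk_eq_of_mem I (x := x) heI]
    refine (mul_self_le_mul_self (norm_nonneg _) (norm_mk_le I _)).trans ?_
    rw [ClosedIdeal.norm_mul_one_sub_sq he]
    have h1 : star x * x * (1 - e) = z * (1 - e) + (star x * x - z) * (1 - e) := by noncomm_ring
    refine (norm_mul_le _ _).trans ((mul_le_of_le_one_left (norm_nonneg _) he').trans ?_)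
    rw [h1]
    refine (norm_add_le _ _).trans ?_
    have h2 : ‖z * (1 - e)‖ ≤ ‖z‖ :=
      (norm_mul_le _ _).trans (mul_le_of_le_one_right (norm_nonneg _) he')
    linarith

instance : CStarAlgebra (CStarQuotient I) where

/-- The quotient map `A → A / I`. -/
def mk : A →⋆ₐ[ℂ] CStarQuotient I :=
  { mkRingHom I with
    commutes' := fun _ => rfl
    map_star' := mk_star I }

end CStarQuotient

/-- The closed two-sided ideal generated by a subset of a C*-algebra. -/
def closedIdealSpan (s : Set A) : Ideal A := (TwoSidedIdeal.span s).asIdeal.closure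

instance (s : Set A) : IsClosed (closedIdealSpan s : Set A) := isClosed_closure

instance (s : Set A) : (closedIdealSpan s).IsTwoSided where
  mul_mem_of_left {a} b ha := by
    have h : Set.MapsTo (fun x => x * b) ((TwoSidedIdeal.span s).asIdeal : Set A)
        ((TwoSidedIdeal.span s).asIdeal : Set A) := fun x hx => Ideal.mul_mem_right b _ hx
    exact h.closure (by fun_prop) ha

end Quotient

/-! ### Woronowicz algebras and the free wreath product -/

/-- A Woronowicz algebra structure (compact quantum group structure) on the unital C*-algebra `A`:
a coproduct with values in the minimal tensor product, and a family `u` of unitary matrices over `A`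
such that the entries generate a dense subalgebra, `Δ(u i j) = ∑ k, u i k ⊗ u k j`, and the
transpose of each member is invertible. -/
structure WoronowiczAlgebra (A : Type u) [CStarAlgebra A] where
  /-- As usual for unital C*-algebras, `1 ≠ 0`. -/
  nontrivial : Nontrivial A
  /-- The coproduct. -/
  comul : A →⋆ₐ[ℂ] MinTensor A A
  /-- The index set of the family. -/
  Λ : Type v
  /-- The sizes of the matrices. -/
  dim : Λ → ℕ
  /-- The matrices. -/
  mat : ∀ l, Matrix (Fin (dim l)) (Fin (dim l)) A
  mat_mem_unitary : ∀ l, mat l ∈ unitary (Matrix (Fin (dim l)) (Fin (dim l)) A)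
  dense_adjoin : Dense (Algebra.adjoin ℂ {a : A | ∃ l i j, a = mat l i j} : Set A)
  comul_mat : ∀ l i j, comul (mat l i j) = ∑ k, MinTensor.tmul (mat l i k) (mat l k j)
  isUnit_transpose : ∀ l, IsUnit (mat l).transpose

namespace WoronowiczAlgebra

variable {A : Type u} [CStarAlgebra A]

/-- The dense `*`-subalgebra `𝒜` generated by the entries of the family of matrices. (By the theory
of compact quantum groups it is also the subalgebra generated by the entries,
and depends on `A` and `Δ` only.) -/
def polynomialAlgebra (W : WoronowiczAlgebra.{u, v} A) : StarSubalgebra ℂ A :=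
  StarAlgebra.adjoin ℂ {a : A | ∃ l i j, a = W.mat l i j}

/-- A Woronowicz algebra is full if it is the enveloping C*-algebra of its dense `*`-subalgebra. -/
def IsFull (W : WoronowiczAlgebra.{u, v} A) : Prop :=
  IsCStarEnvelope W.polynomialAlgebra.subtype

end WoronowiczAlgebra

section Wreath

variable (A : Type u) [CStarAlgebra A] (n : ℕ)

/-- The C*-algebra `A^{*n} * A_aut(X_n)`. -/
abbrev PreWreath : Type u := CStarFreeProduct₂ (CStarFreeProduct fun _ : Fin n => A) (QPerm.{u} n)

namespace PreWreath

variable {A n}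

/-- The canonical map of the `i`-th copy of `A` into `A^{*n} * A_aut(X_n)`. -/
def ν (i : Fin n) : A →⋆ₐ[ℂ] PreWreath A n :=
  (CStarFreeProduct₂.inl _ _).comp (CStarFreeProduct.ι (fun _ : Fin n => A) i)

/-- The generators of `A_aut(X_n)`, in `A^{*n} * A_aut(X_n)`. -/
def x (i j : Fin n) : PreWreath A n := CStarFreeProduct₂.inr _ _ (QPerm.x i j)

variable (A n) in
/-- The commutators `ν_k(a) x_{ki} - x_{ki} ν_k(a)`. -/
def relations : Set (PreWreath A n) :=
  {y | ∃ (k i : Fin n) (a : A), y = ν k a * x k i - x k i * ν k a}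

end PreWreath

/-- The free wreath product `A *_w A_aut(X_n)`: the quotient of `A^{*n} * A_aut(X_n)` by the
closed two-sided ideal generated by the elements `ν_k(a) x_{ki} - x_{ki} ν_k(a)`. -/
abbrev FreeWreath : Type u := CStarQuotient (closedIdealSpan (PreWreath.relations A n))

namespace FreeWreath

variable {A n}

/-- The canonical maps `ν_i : A → A *_w A_aut(X_n)`. -/
def ν (i : Fin n) : A →⋆ₐ[ℂ] FreeWreath A n := (CStarQuotient.mk _).comp (PreWreath.ν i)

/-- The elements `x_{ij}` of `A *_w A_aut(X_n)`. -/
def x (i j : Fin n) : FreeWreath A n := CStarQuotient.mk _ (PreWreath.x i j)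

end FreeWreath

end Wreath

end

/-! The free wreath product is universal among C*-algebras carrying `n` star-homomorphisms `ν_k`
from `A` and a magic unitary `x` (projections, orthogonal and summing to 1 along each row and each
column) such that the values of `ν_k` commute with the `k`-th row of `x`. Its coproduct therefore
amounts to finding such data in the minimal tensor square. The matrix `∑ k, x_ik ⊗ x_kj` is again
magic (`IsMagicUnitary.tensor`). The map `a ↦ ∑ k, (ν_i ⊗ ν_k)(Δ a) (x_ik ⊗ 1)` is a
star-homomorphism because, for fixed `i`, the projections `x_ik ⊗ 1` form a partition of unity and
each commutes with the homomorphism it multiplies (`StarAlgHom.sumProjections`). The two families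
commute as required by `IsFreeWreath.commute_comulν`.

Each unitary matrix `u` of `A` gives the matrix with entries `ν_i(u_ab) x_ij`, indexed by pairs.
Both its adjoint and its transpose have the transposed shape, with entries `ν_j(v_ab) x_ji`, where
`v` is the adjoint or transpose of `u`. The magic relations collapse a product of the two shapes to
a matrix product over `A`, so unitarity and invertibility of the transpose are inherited from `u`.
The choice `u = 1` makes the `x_ij` entries too, while `∑ j, x_ij = 1` recovers `ν_i(u_ab)`; this
gives density.

For fullness, a star-homomorphism on the dense star-subalgebra of the product restricts along each
`ν_i` to the dense star-subalgebra of `A`, and extends to `A` when `A` is full. The commutation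
relations survive by continuity, so the universal property extends the whole homomorphism. Since
star-homomorphisms of C*-algebras are contractive, the norm dominates every C*-seminorm. -/

/-! ### Homomorphisms and closed subalgebras controlled by generators -/

/-- An algebra homomorphism which commutes with the involution on a generating set, as a
`*`-homomorphism. -/
def StarAlgHom.ofGenerators {𝒜 : Type u} {B : Type w} [Ring 𝒜] [StarRing 𝒜] [Algebra ℂ 𝒜]
    [StarModule ℂ 𝒜] [Ring B] [StarRing B] [Algebra ℂ B] [StarModule ℂ B] (f : 𝒜 →ₐ[ℂ] B)
    (s : Set 𝒜) (hs : Algebra.adjoin ℂ s = ⊤) (h : ∀ a ∈ s, f (star a) = star (f a)) :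
    𝒜 →⋆ₐ[ℂ] B :=
  { f with
    map_star' := fun a => by
      change f (star a) = star (f a)
      have ha : a ∈ Algebra.adjoin ℂ s := hs ▸ Algebra.mem_top
      induction ha using Algebra.adjoin_induction with
      | mem x hx => exact h x hx
      | algebraMap c => rw [← algebraMap_star_comm, AlgHom.commutes, AlgHom.commutes,
          algebraMap_star_comm]
      | add x y _ _ hx hy => rw [star_add, map_add, map_add, star_add, hx, hy]
      | mul x y _ _ hx hy => rw [star_mul, map_mul, map_mul, star_mul, hx, hy] }

theorem StarAlgHom.continuous_of_cstarAlgebra {A : Type u} [CStarAlgebra A] {B : Type w}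
    [CStarAlgebra B] (f : A →⋆ₐ[ℂ] B) : Continuous f :=
  AddMonoidHomClass.continuous_of_bound f 1 fun a => by
    rw [one_mul]; exact NonUnitalStarAlgHom.norm_apply_le f a

/-- A closed subalgebra containing the values of an algebra homomorphism with dense range on a
generating set is everything. -/
theorem Subalgebra.eq_top_of_denseRange {𝒜 : Type u} {B : Type w} [Ring 𝒜] [Algebra ℂ 𝒜]
    [NormedRing B] [Algebra ℂ B] {j : 𝒜 →ₐ[ℂ] B} (hj : DenseRange j) {s : Set 𝒜}
    (hs : Algebra.adjoin ℂ s = ⊤) {S : Subalgebra ℂ B} (hS : IsClosed (S : Set B))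
    (h : ∀ a ∈ s, j a ∈ S) : S = ⊤ := by
  have h1 : ⊤ ≤ S.comap j := hs ▸ Algebra.adjoin_le h
  refine eq_top_iff.mpr fun b _ => ?_
  exact hS.closure_subset_iff.mpr (Set.range_subset_iff.mpr fun a => h1 (Algebra.mem_top (x := a)))
    (hj b)

/-! ### Universal properties of enveloping C*-algebras and free products -/

namespace CStarEnvelope

variable {𝒜 : Type u} [Ring 𝒜] [StarRing 𝒜] [Algebra ℂ 𝒜] [StarModule ℂ 𝒜] [HasCStarEnvelope 𝒜]
  {B : Type w} [CStarAlgebra B]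

/-- The universal property of the enveloping C*-algebra. -/
noncomputable def lift (φ : 𝒜 →⋆ₐ[ℂ] B) : CStarEnvelope 𝒜 →⋆ₐ[ℂ] B :=
  CStarSeminorm.Completion.lift φ fun a =>
    -- The norm pulled back along `φ` is itself a C*-seminorm, hence below the greatest one.
    le_ciSup (HasCStarEnvelope.bddAbove a) (CStarSeminorm.ofHom φ)

theorem lift_of (φ : 𝒜 →⋆ₐ[ℂ] B) (a : 𝒜) : lift φ (of 𝒜 a) = φ a :=
  CStarSeminorm.Completion.lift_of _ _ _

theorem subalgebra_eq_top {s : Set 𝒜} (hs : Algebra.adjoin ℂ s = ⊤)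
    {S : Subalgebra ℂ (CStarEnvelope 𝒜)} (hS : IsClosed (S : Set (CStarEnvelope 𝒜)))
    (h : ∀ a ∈ s, of 𝒜 a ∈ S) : S = ⊤ :=
  Subalgebra.eq_top_of_denseRange (j := (of 𝒜).toAlgHom)
    (CStarSeminorm.Completion.denseRange_of _) hs hS h

end CStarEnvelope

namespace CStarFreeProduct

variable {I : Type v} [DecidableEq I] {A : I → Type u} [∀ i, CStarAlgebra (A i)]
  {B : Type w} [CStarAlgebra B]

/-- The universal property of the free product C*-algebra. -/
noncomputable def lift (f : ∀ i, A i →⋆ₐ[ℂ] B) : CStarFreeProduct A →⋆ₐ[ℂ] B :=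
  CStarEnvelope.lift <| StarAlgHom.ofGenerators (AlgFreeProduct.lift fun i => (f i).toAlgHom) _
    AlgFreeProduct.adjoin_range fun a ha => by
      obtain ⟨i, a, rfl⟩ := Set.mem_iUnion.mp ha
      have h : star (AlgFreeProduct.ι A i a) = AlgFreeProduct.ι A i (star a) :=
        (map_star (AlgFreeProduct.ιStar A i) a).symm
      rw [h, AlgFreeProduct.lift_ι, AlgFreeProduct.lift_ι]
      exact map_star (f i) a

theorem lift_ι (f : ∀ i, A i →⋆ₐ[ℂ] B) (i : I) (a : A i) : lift f (ι A i a) = f i a :=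
  (CStarEnvelope.lift_of _ _).trans (AlgFreeProduct.lift_ι (fun i => (f i).toAlgHom) i a)

theorem subalgebra_eq_top {S : Subalgebra ℂ (CStarFreeProduct A)}
    (hS : IsClosed (S : Set (CStarFreeProduct A))) (h : ∀ i a, ι A i a ∈ S) : S = ⊤ :=
  CStarEnvelope.subalgebra_eq_top AlgFreeProduct.adjoin_range hS fun a ha => by
    obtain ⟨i, a, rfl⟩ := Set.mem_iUnion.mp ha
    exact h i a

end CStarFreeProduct

namespace CStarFreeProduct₂

variable {A B : Type u} [CStarAlgebra A] [CStarAlgebra B] {C : Type w} [CStarAlgebra C]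

/-- The pair of `*`-homomorphisms `f`, `g`, as a family. -/
def pairHom (f : A →⋆ₐ[ℂ] C) (g : B →⋆ₐ[ℂ] C) : ∀ b, PairFamily A B b →⋆ₐ[ℂ] C
  | false => f
  | true => g

/-- The universal property of the free product of two C*-algebras. -/
noncomputable def lift (f : A →⋆ₐ[ℂ] C) (g : B →⋆ₐ[ℂ] C) : CStarFreeProduct₂ A B →⋆ₐ[ℂ] C :=
  CStarFreeProduct.lift (pairHom f g)

theorem lift_inl (f : A →⋆ₐ[ℂ] C) (g : B →⋆ₐ[ℂ] C) (a : A) : lift f g (inl A B a) = f a :=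
  CStarFreeProduct.lift_ι (pairHom f g) false a

theorem lift_inr (f : A →⋆ₐ[ℂ] C) (g : B →⋆ₐ[ℂ] C) (b : B) : lift f g (inr A B b) = g b :=
  CStarFreeProduct.lift_ι (pairHom f g) true b

theorem subalgebra_eq_top {S : Subalgebra ℂ (CStarFreeProduct₂ A B)}
    (hS : IsClosed (S : Set (CStarFreeProduct₂ A B))) (hl : ∀ a, inl A B a ∈ S)
    (hr : ∀ b, inr A B b ∈ S) : S = ⊤ :=
  CStarFreeProduct.subalgebra_eq_top hS fun
    | false, a => hl a
    | true, b => hr b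

end CStarFreeProduct₂

/-! ### Magic unitaries and the quantum permutation algebra -/

/-- A magic unitary: a matrix of projections with the relations of `𝒜_t(n)`. -/
structure IsMagicUnitary {n : ℕ} {B : Type w} [Ring B] [StarRing B] (X : Fin n → Fin n → B) :
    Prop where
  star_eq : ∀ i j, star (X i j) = X i j
  mul_row : ∀ i j k, X i j * X i k = if j = k then X i j else 0
  mul_col : ∀ i j k, X j i * X k i = if j = k then X j i else 0
  sum_row : ∀ i, ∑ l, X i l = 1
  sum_col : ∀ i, ∑ l, X l i = 1

namespace IsMagicUnitary

variable {n : ℕ} {B : Type w}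

theorem map {C : Type v} [Ring B] [StarRing B] [Algebra ℂ B] [Ring C] [StarRing C] [Algebra ℂ C]
    {X : Fin n → Fin n → B} (hX : IsMagicUnitary X) (f : B →⋆ₐ[ℂ] C) :
    IsMagicUnitary fun i j => f (X i j) where
  star_eq i j := by rw [← map_star, hX.star_eq]
  mul_row i j k := by rw [← map_mul, hX.mul_row, apply_ite f, map_zero]
  mul_col i j k := by rw [← map_mul, hX.mul_col, apply_ite f, map_zero]
  sum_row i := by rw [← map_sum, hX.sum_row, map_one]
  sum_col i := by rw [← map_sum, hX.sum_col, map_one]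

/-- Transports the relations back along an inclusion, so that a magic unitary of a C*-algebra is
also one over a star-subalgebra containing its entries. -/
theorem of_map {C : Type v} [Ring B] [StarRing B] [Algebra ℂ B] [Ring C] [StarRing C]
    [Algebra ℂ C] {X : Fin n → Fin n → B} (f : B →⋆ₐ[ℂ] C) (hf : Function.Injective f)
    (hX : IsMagicUnitary fun i j => f (X i j)) : IsMagicUnitary X where
  star_eq i j := hf (by rw [map_star, hX.star_eq])
  mul_row i j k := hf (by rw [map_mul, hX.mul_row, apply_ite f, map_zero])
  mul_col i j k := hf (by rw [map_mul, hX.mul_col, apply_ite f, map_zero])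
  sum_row i := hf (by rw [map_sum, hX.sum_row, map_one])
  sum_col i := hf (by rw [map_sum, hX.sum_col, map_one])

theorem qPermAlg (n : ℕ) : IsMagicUnitary (QPermAlg.x.{u} (n := n)) where
  star_eq := QPermAlg.star_x
  mul_row := QPermAlg.x_mul_row
  mul_col := QPermAlg.x_mul_col
  sum_row := QPermAlg.sum_row
  sum_col := QPermAlg.sum_col

/-- The identity permutation; mapping the generators to it is the counit of the quantum permutation
group. It serves to produce a nonzero quotient of the free wreath product. -/
theorem one [Ring B] [StarRing B] :
    IsMagicUnitary fun i j : Fin n => if i = j then (1 : B) else 0 where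
  star_eq i j := by split_ifs <;> simp
  mul_row i j k := by
    by_cases h : i = j
    · subst h; simp
    · simp [h]
  mul_col i j k := by
    by_cases h : j = i
    · subst h; simp [eq_comm]
    · simp [h]
  sum_row i := by simp
  sum_col i := by simp

/-- The universal property of `A_aut(X_n)`. -/
noncomputable def lift [CStarAlgebra B] {X : Fin n → Fin n → B} (hX : IsMagicUnitary X) :
    QPerm.{u} n →⋆ₐ[ℂ] B :=
  have hrel : ∀ ⦃a b⦄, QPermRel.{u} n a b →
      FreeAlgebra.lift ℂ (fun p : ULift.{u} (Fin n × Fin n) => X p.down.1 p.down.2) a =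
      FreeAlgebra.lift ℂ (fun p : ULift.{u} (Fin n × Fin n) => X p.down.1 p.down.2) b := by
    intro a b hab
    cases hab with
    | row_mul i j k =>
      rw [map_mul, FreeAlgebra.lift_ι_apply, FreeAlgebra.lift_ι_apply, hX.mul_row]
      split_ifs
      · rw [FreeAlgebra.lift_ι_apply]
      · rw [map_zero]
    | col_mul i j k =>
      rw [map_mul, FreeAlgebra.lift_ι_apply, FreeAlgebra.lift_ι_apply, hX.mul_col]
      split_ifs
      · rw [FreeAlgebra.lift_ι_apply]
      · rw [map_zero]
    | row_sum i =>
      rw [map_sum, map_one, ← hX.sum_row i]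
      exact Finset.sum_congr rfl fun l _ => FreeAlgebra.lift_ι_apply _ _
    | col_sum i =>
      rw [map_sum, map_one, ← hX.sum_col i]
      exact Finset.sum_congr rfl fun l _ => FreeAlgebra.lift_ι_apply _ _
  have hx : ∀ i j, RingQuot.liftAlgHom ℂ ⟨_, hrel⟩ (QPermAlg.x.{u} i j) = X i j := fun i j =>
    (RingQuot.liftAlgHom_mkAlgHom_apply ℂ _ _ _).trans (FreeAlgebra.lift_ι_apply _ _)
  CStarEnvelope.lift <| StarAlgHom.ofGenerators (RingQuot.liftAlgHom ℂ ⟨_, hrel⟩ :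
      QPermAlg.{u} n →ₐ[ℂ] B) _ QPermAlg.adjoin_range fun a ha => by
    obtain ⟨p, rfl⟩ := ha
    exact (congrArg _ (QPermAlg.star_x _ _)).trans
      ((hx _ _).trans ((hX.star_eq _ _).symm.trans (congrArg star (hx _ _).symm)))

theorem lift_x [CStarAlgebra B] {X : Fin n → Fin n → B} (hX : IsMagicUnitary X) (i j : Fin n) :
    hX.lift (QPerm.x.{u} i j) = X i j :=
  (CStarEnvelope.lift_of _ _).trans
    ((RingQuot.liftAlgHom_mkAlgHom_apply ℂ _ _ _).trans (FreeAlgebra.lift_ι_apply _ _))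

end IsMagicUnitary

/-! ### Quotients and the universal property of the free wreath product -/

/-- A `*`-homomorphism vanishing on a set descends to the quotient by the closed two-sided ideal
generated by the set. -/
theorem closedIdealSpan_le_ker {A : Type u} [CStarAlgebra A] {B : Type w} [CStarAlgebra B]
    (f : A →⋆ₐ[ℂ] B) {s : Set A} (h : ∀ a ∈ s, f a = 0) {a : A} (ha : a ∈ closedIdealSpan s) :
    f a = 0 := by
  have hc : IsClosed {a : A | f a = 0} :=
    isClosed_eq (StarAlgHom.continuous_of_cstarAlgebra f) continuous_const
  refine hc.closure_subset_iff.mpr (fun x hx => ?_) ha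
  have h1 : TwoSidedIdeal.span s ≤ TwoSidedIdeal.ker f :=
    TwoSidedIdeal.span_le.mpr fun a ha => (TwoSidedIdeal.mem_ker f).mpr (h a ha)
  exact (TwoSidedIdeal.mem_ker f).mp (h1 (TwoSidedIdeal.mem_asIdeal.mp hx))

namespace CStarQuotient

variable {A : Type u} [CStarAlgebra A] {B : Type w} [CStarAlgebra B]
  (I : Ideal A) [I.IsTwoSided] [IsClosed (I : Set A)]

/-- The universal property of the quotient by a closed two-sided ideal. -/
def lift (f : A →⋆ₐ[ℂ] B) (h : ∀ a ∈ I, f a = 0) : CStarQuotient I →⋆ₐ[ℂ] B :=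
  { (Ideal.Quotient.lift I (f : A →+* B) h : A ⧸ I →+* B) with
    commutes' := fun c => AlgHomClass.commutes f c
    map_star' := fun x => by
      obtain ⟨x, rfl⟩ := mkRingHom_surjective I x
      exact map_star f x }

end CStarQuotient

namespace FreeWreath

variable {A : Type u} [CStarAlgebra A] {n : ℕ} {B : Type w} [CStarAlgebra B]

theorem isMagicUnitary_x : IsMagicUnitary (x : Fin n → Fin n → FreeWreath A n) :=
  ((IsMagicUnitary.qPermAlg n).map (CStarEnvelope.of (QPermAlg.{u} n))).map
    ((CStarQuotient.mk _).comp (CStarFreeProduct₂.inr _ _))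

theorem commute_ν_x (k i : Fin n) (a : A) : Commute (ν k a) (x k i) := by
  have h : PreWreath.ν k a * PreWreath.x k i - PreWreath.x k i * PreWreath.ν k a ∈
      closedIdealSpan (PreWreath.relations A n) :=
    subset_closure (TwoSidedIdeal.subset_span ⟨k, i, a, rfl⟩)
  have h1 := (CStarQuotient.mkRingHom_eq (closedIdealSpan (PreWreath.relations A n))).mpr h
  rwa [map_mul, map_mul] at h1

/-- The `*`-homomorphism from `A^{*n} * A_aut(X_n)` given by `*`-homomorphisms `f i` on the copies
of `A` and a magic unitary. -/
noncomputable def preLift {X : Fin n → Fin n → B} (f : Fin n → A →⋆ₐ[ℂ] B)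
    (hX : IsMagicUnitary X) : PreWreath A n →⋆ₐ[ℂ] B :=
  CStarFreeProduct₂.lift (CStarFreeProduct.lift f) hX.lift

theorem preLift_ν {X : Fin n → Fin n → B} (f : Fin n → A →⋆ₐ[ℂ] B) (hX : IsMagicUnitary X)
    (i : Fin n) (a : A) : preLift f hX (PreWreath.ν i a) = f i a :=
  (CStarFreeProduct₂.lift_inl _ _ _).trans (CStarFreeProduct.lift_ι f i a)

theorem preLift_x {X : Fin n → Fin n → B} (f : Fin n → A →⋆ₐ[ℂ] B) (hX : IsMagicUnitary X)
    (i j : Fin n) : preLift f hX (PreWreath.x i j) = X i j :=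
  (CStarFreeProduct₂.lift_inr _ _ _).trans (hX.lift_x i j)

/-- The universal property of the free wreath product. -/
noncomputable def lift {X : Fin n → Fin n → B} (f : Fin n → A →⋆ₐ[ℂ] B) (hX : IsMagicUnitary X)
    (hc : ∀ k i a, Commute (f k a) (X k i)) : FreeWreath A n →⋆ₐ[ℂ] B :=
  CStarQuotient.lift _ (preLift f hX) fun _ ha => closedIdealSpan_le_ker _ (by
    rintro _ ⟨k, i, a, rfl⟩
    rw [map_sub, map_mul, map_mul, preLift_ν, preLift_x, (hc k i a).eq, sub_self]) ha

theorem lift_ν {X : Fin n → Fin n → B} (f : Fin n → A →⋆ₐ[ℂ] B) (hX : IsMagicUnitary X)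
    (hc : ∀ k i a, Commute (f k a) (X k i)) (i : Fin n) (a : A) :
    lift f hX hc (ν i a) = f i a :=
  preLift_ν f hX i a

theorem lift_x {X : Fin n → Fin n → B} (f : Fin n → A →⋆ₐ[ℂ] B) (hX : IsMagicUnitary X)
    (hc : ∀ k i a, Commute (f k a) (X k i)) (i j : Fin n) : lift f hX hc (x i j) = X i j :=
  preLift_x f hX i j

/-- The subalgebra is pulled back along the surjective quotient map and then along both legs of the
free product. Closedness passes to these preimages and is needed there, since generators only
generate a dense part of an enveloping C*-algebra. -/
theorem subalgebra_eq_top {S : Subalgebra ℂ (FreeWreath A n)}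
    (hS : IsClosed (S : Set (FreeWreath A n))) (hν : ∀ i a, ν i a ∈ S) (hx : ∀ i j, x i j ∈ S) :
    S = ⊤ := by
  let m : PreWreath A n →⋆ₐ[ℂ] FreeWreath A n := CStarQuotient.mk _
  have h1 : S.comap m.toAlgHom = ⊤ := by
    refine CStarFreeProduct₂.subalgebra_eq_top (hS.preimage (StarAlgHom.continuous_of_cstarAlgebra m)) (fun a => ?_)
      fun b => ?_
    · let l := m.comp (CStarFreeProduct₂.inl (CStarFreeProduct fun _ : Fin n => A) (QPerm.{u} n))
      have h2 : S.comap l.toAlgHom = ⊤ :=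
        CStarFreeProduct.subalgebra_eq_top (hS.preimage (StarAlgHom.continuous_of_cstarAlgebra l)) hν
      exact h2.ge (Algebra.mem_top (x := a))
    · let r := m.comp (CStarFreeProduct₂.inr (CStarFreeProduct fun _ : Fin n => A) (QPerm.{u} n))
      have h2 : S.comap r.toAlgHom = ⊤ :=
        CStarEnvelope.subalgebra_eq_top QPermAlg.adjoin_range (hS.preimage (StarAlgHom.continuous_of_cstarAlgebra r)) (by
          rintro _ ⟨p, rfl⟩
          exact hx p.1 p.2)
      exact h2.ge (Algebra.mem_top (x := b))
  refine eq_top_iff.mpr fun y _ => ?_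
  obtain ⟨z, rfl⟩ := CStarQuotient.mkRingHom_surjective _ y
  exact h1.ge (Algebra.mem_top (x := z))

end FreeWreath

/-! ### Calculus in the minimal tensor product -/

namespace MinTensor

variable {A B C D : Type u} [CStarAlgebra A] [CStarAlgebra B] [CStarAlgebra C] [CStarAlgebra D]

theorem tmul_mul_tmul (a a' : A) (b b' : B) :
    tmul a b * tmul a' b' = tmul (a * a') (b * b') := by
  rw [tmul, tmul, ← map_mul, Algebra.TensorProduct.tmul_mul_tmul]; rfl

theorem star_tmul (a : A) (b : B) : star (tmul a b) = tmul (star a) (star b) := by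
  rw [tmul, ← map_star, TensorProduct.star_tmul]; rfl

theorem one_tmul_one : tmul (1 : A) (1 : B) = 1 :=
  map_one (CStarSeminorm.Completion.of (minTensorNorm A B))

theorem zero_tmul (b : B) : tmul (0 : A) b = 0 := by
  rw [tmul, TensorProduct.zero_tmul, map_zero]

theorem tmul_zero (a : A) : tmul a (0 : B) = 0 := by
  rw [tmul, TensorProduct.tmul_zero, map_zero]

theorem sum_tmul {ι : Type v} (s : Finset ι) (f : ι → A) (b : B) :
    tmul (∑ i ∈ s, f i) b = ∑ i ∈ s, tmul (f i) b := by
  rw [tmul, TensorProduct.sum_tmul, map_sum]; rfl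

theorem tmul_sum {ι : Type v} (s : Finset ι) (a : A) (f : ι → B) :
    tmul a (∑ i ∈ s, f i) = ∑ i ∈ s, tmul a (f i) := by
  rw [tmul, TensorProduct.tmul_sum, map_sum]; rfl

/-- Both sides are continuous and additive in `z`, which reduces the claim to elementary tensors,
where each leg commutes separately. -/
theorem commute_map_tmul {f : A →⋆ₐ[ℂ] C} {g : B →⋆ₐ[ℂ] D} {c : C} {d : D}
    (hc : ∀ a, Commute (f a) c) (hd : ∀ b, Commute (g b) d) (z : MinTensor A B) :
    Commute (map f g z) (tmul c d) := by
  have hm : Continuous (map f g) := StarAlgHom.continuous_of_cstarAlgebra (map f g)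
  refine CStarSeminorm.Completion.ext_coe _ (f := fun z => map f g z * tmul c d)
    (g := fun z => tmul c d * map f g z) (hm.mul continuous_const) (continuous_const.mul hm)
    (fun y => ?_) z
  change map f g (CStarSeminorm.Completion.of _ y) * tmul c d =
    tmul c d * map f g (CStarSeminorm.Completion.of _ y)
  induction y using TensorProduct.induction_on with
  | zero => rw [map_zero, map_zero, zero_mul, mul_zero]
  | add y y' h h' => rw [map_add, map_add, add_mul, mul_add, h, h']
  | tmul a b =>
    change map f g (tmul a b) * _ = _ * map f g (tmul a b)
    rw [map_tmul, tmul_mul_tmul, tmul_mul_tmul, (hc a).eq, (hd b).eq]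

end MinTensor

/-- In a product of two entries of one row, orthogonality in the left leg forces the inner indices
to agree, and orthogonality in the right leg finishes; for columns the legs exchange roles. -/
theorem IsMagicUnitary.tensor {A : Type u} [CStarAlgebra A] {n : ℕ} {X : Fin n → Fin n → A}
    (hX : IsMagicUnitary X) :
    IsMagicUnitary fun i j => ∑ k, MinTensor.tmul (X i k) (X k j) where
  star_eq i j := by simp_rw [star_sum, MinTensor.star_tmul, hX.star_eq]
  mul_row i j k := by
    simp_rw [Finset.sum_mul_sum, MinTensor.tmul_mul_tmul, hX.mul_row i]
    have h : ∀ l m : Fin n, MinTensor.tmul (if l = m then X i l else 0) (X l j * X m k) =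
        if l = m then MinTensor.tmul (X i l) (X l j * X l k) else 0 := fun l m => by
      split_ifs with h
      · rw [h]
      · rw [MinTensor.zero_tmul]
    simp_rw [h, Finset.sum_ite_eq, Finset.mem_univ, if_true, hX.mul_row]
    split_ifs
    · rfl
    · simp_rw [MinTensor.tmul_zero, Finset.sum_const_zero]
  mul_col i j k := by
    simp_rw [Finset.sum_mul_sum, MinTensor.tmul_mul_tmul, hX.mul_col i]
    have h : ∀ l m : Fin n, MinTensor.tmul (X j l * X k m) (if l = m then X l i else 0) =
        if l = m then MinTensor.tmul (X j l * X k l) (X l i) else 0 := fun l m => by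
      split_ifs with h
      · rw [h]
      · rw [MinTensor.tmul_zero]
    simp_rw [h, Finset.sum_ite_eq, Finset.mem_univ, if_true, hX.mul_col]
    split_ifs
    · rfl
    · simp_rw [MinTensor.zero_tmul, Finset.sum_const_zero]
  sum_row i := by
    rw [Finset.sum_comm]
    simp_rw [← MinTensor.tmul_sum, hX.sum_row, ← MinTensor.sum_tmul, hX.sum_row,
      MinTensor.one_tmul_one]
  sum_col i := by
    rw [Finset.sum_comm]
    simp_rw [← MinTensor.sum_tmul, hX.sum_col, ← MinTensor.tmul_sum, hX.sum_col,
      MinTensor.one_tmul_one]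

/-! ### Gluing homomorphisms along a partition of unity -/

/-- The `*`-homomorphism `a ↦ ∑ k, g k a * p k`, for a partition of unity into projections `p k`
which commute with the values of the `*`-homomorphisms `g k`. -/
def StarAlgHom.sumProjections {ι : Type v} [Fintype ι] [DecidableEq ι] {A : Type u} {C : Type w}
    [CStarAlgebra A] [CStarAlgebra C] (g : ι → A →⋆ₐ[ℂ] C) (p : ι → C)
    (hstar : ∀ k, star (p k) = p k) (hmul : ∀ j k, p j * p k = if j = k then p j else 0)
    (hsum : ∑ k, p k = 1) (hc : ∀ k a, Commute (g k a) (p k)) : A →⋆ₐ[ℂ] C where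
  toFun a := ∑ k, g k a * p k
  map_one' := by simp_rw [map_one, one_mul, hsum]
  map_mul' a b := by
    -- Moving `p k` to the left of `g k b` brings it next to `p j`, so the cross terms vanish.
    have h : ∀ j k, g j a * p j * (g k b * p k) =
        if j = k then g j a * g j b * p j else 0 := fun j k => by
      rw [(hc k b).eq, mul_assoc, ← mul_assoc (p j), hmul]
      split_ifs with h
      · rw [h, ← (hc k b).eq, mul_assoc]
      · rw [zero_mul, mul_zero]
    simp_rw [Finset.sum_mul_sum, h, Finset.sum_ite_eq, Finset.mem_univ, if_true, map_mul]
  map_zero' := by simp_rw [map_zero, zero_mul, Finset.sum_const_zero]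
  map_add' a b := by simp_rw [map_add, add_mul, Finset.sum_add_distrib]
  commutes' c := by
    simp_rw [AlgHomClass.commutes, ← Finset.mul_sum, hsum, mul_one]
  map_star' a := by
    simp_rw [star_sum, star_mul, hstar, map_star]
    exact Finset.sum_congr rfl fun k _ => by rw [← map_star, (hc k _).eq]

/-! ### Block matrices built from a magic unitary -/

section Block

variable {n : ℕ} {A : Type u} {B : Type w} [Ring A] [Ring B] {m : Type v}

/-- The matrix with entries `ν i (M a b) * X i j` at `((i, a), (j, b))`. -/
def Matrix.rowBlock (ν : Fin n → A →+* B) (X : Fin n → Fin n → B) (M : Matrix m m A) :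
    Matrix (Fin n × m) (Fin n × m) B :=
  .of fun p q => ν p.1 (M p.2 q.2) * X p.1 q.1

/-- The matrix with entries `ν j (M a b) * X j i` at `((i, a), (j, b))`. -/
def Matrix.colBlock (ν : Fin n → A →+* B) (X : Fin n → Fin n → B) (M : Matrix m m A) :
    Matrix (Fin n × m) (Fin n × m) B :=
  .of fun p q => ν q.1 (M p.2 q.2) * X q.1 p.1

variable {ν : Fin n → A →+* B} {X : Fin n → Fin n → B}

/-- Transposition moves entries without reversing products inside them, so no commutation is needed
here, unlike for the adjoint. -/
theorem Matrix.transpose_rowBlock (M : Matrix m m A) :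
    (rowBlock ν X M).transpose = colBlock ν X M.transpose := rfl

variable [StarRing B]

/-- The involution reverses the product `ν i (M a b) * X i j`; the commutation `hc` restores the
order. -/
theorem Matrix.conjTranspose_rowBlock [StarRing A] (hX : IsMagicUnitary X)
    (hc : ∀ k i a, Commute (ν k a) (X k i)) (hν : ∀ k a, ν k (star a) = star (ν k a))
    (M : Matrix m m A) : (rowBlock ν X M).conjTranspose = colBlock ν X M.conjTranspose := by
  ext p q
  simp only [rowBlock, colBlock, conjTranspose_apply, of_apply, star_mul, hX.star_eq, ← hν]
  exact (hc _ _ _).eq.symm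

variable [Fintype m] [DecidableEq m]

/-- Once the entries of `X` are brought together, column orthogonality leaves only `i = k`. Then a
single `ν i` is applied to the entries of `M * N`, and the remaining sum over `j` is a row sum of
`X`. -/
theorem IsMagicUnitary.rowBlock_mul_colBlock (hX : IsMagicUnitary X)
    (hc : ∀ k i a, Commute (ν k a) (X k i)) {M N : Matrix m m A} (h : M * N = 1) :
    M.rowBlock ν X * N.colBlock ν X = 1 := by
  ext ⟨i, a⟩ ⟨k, c⟩
  simp only [Matrix.mul_apply, Matrix.rowBlock, Matrix.colBlock, Matrix.of_apply,
    Fintype.sum_prod_type]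
  have h1 : ∀ j b, ν i (M a b) * X i j * (ν k (N b c) * X k j) =
      if i = k then ν i (M a b) * ν i (N b c) * X i j else 0 := fun j b => by
    rw [(hc k j _).eq, mul_assoc, ← mul_assoc (X i j), hX.mul_col]
    split_ifs with hik
    · rw [hik, ← (hc k j _).eq, mul_assoc]
    · rw [zero_mul, mul_zero]
  simp_rw [h1]
  by_cases hik : i = k
  · subst hik
    simp_rw [if_true, ← map_mul, ← Finset.sum_mul, ← map_sum, ← Matrix.mul_apply, h,
      ← Finset.mul_sum, hX.sum_row, mul_one, Matrix.one_apply, Prod.mk.injEq, true_and]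
    split_ifs
    · rw [map_one]
    · rw [map_zero]
  · simp [hik]

/-- Row orthogonality leaves only `j = k`. Here `ν i` varies with the summation index, so `M * N =
1` is used first, for each `i`; its entries are 0 or 1, on which all `ν i` agree, and a column sum
of `X` remains. -/
theorem IsMagicUnitary.colBlock_mul_rowBlock (hX : IsMagicUnitary X)
    (hc : ∀ k i a, Commute (ν k a) (X k i)) {M N : Matrix m m A} (h : M * N = 1) :
    M.colBlock ν X * N.rowBlock ν X = 1 := by
  ext ⟨j, b⟩ ⟨k, c⟩
  simp only [Matrix.mul_apply, Matrix.rowBlock, Matrix.colBlock, Matrix.of_apply,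
    Fintype.sum_prod_type]
  have h1 : ∀ i a, ν i (M b a) * X i j * (ν i (N a c) * X i k) =
      if j = k then ν i (M b a) * ν i (N a c) * X i j else 0 := fun i a => by
    rw [(hc i k _).eq, mul_assoc, ← mul_assoc (X i j), hX.mul_row]
    split_ifs with hjk
    · rw [← (hc i j _).eq, mul_assoc]
    · rw [zero_mul, mul_zero]
  simp_rw [h1]
  by_cases hjk : j = k
  · subst hjk
    simp_rw [if_true, ← map_mul, ← Finset.sum_mul, ← map_sum, ← Matrix.mul_apply, h,
      Matrix.one_apply, Prod.mk.injEq, true_and]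
    split_ifs
    · simp_rw [map_one, one_mul, hX.sum_col]
    · simp_rw [map_zero, zero_mul, Finset.sum_const_zero]
  · simp [hjk]

end Block

/-! ### Enveloping C*-algebras and extension of homomorphisms -/

section Extend

variable {𝒜 : Type u} [Ring 𝒜] [StarRing 𝒜] [Algebra ℂ 𝒜] [StarModule ℂ 𝒜]
  {A : Type v} [CStarAlgebra A] {B : Type w} [CStarAlgebra B]

/-- A `*`-homomorphism with dense range into a C*-algebra identifies the latter with the completion
with respect to the pullback of the norm. -/
theorem CStarSeminorm.Completion.bijective_lift {j : 𝒜 →⋆ₐ[ℂ] A} (hj : DenseRange j) :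
    Function.Bijective (lift (q := CStarSeminorm.ofHom j) j fun _ => le_rfl) := by
  set e := lift (q := CStarSeminorm.ofHom j) j fun _ => le_rfl
  have he : ∀ a, e (of _ a) = j a := lift_of j _
  have hc : Continuous e := StarAlgHom.continuous_of_cstarAlgebra e
  have hiso : Isometry e := AddMonoidHomClass.isometry_of_norm e
    (ext_coe _ (f := fun z => ‖e z‖) (g := fun z => ‖z‖) (continuous_norm.comp hc) continuous_norm fun a =>
      (congrArg norm (he a)).trans (norm_of (CStarSeminorm.ofHom j) a).symm)
  refine ⟨hiso.injective, Set.range_eq_univ.mp ?_⟩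
  -- The range of an isometry from a complete space is closed, and it contains the dense range of
  -- `j`.
  rw [← hiso.isClosedEmbedding.isClosed_range.closure_eq]
  have hsub : Set.range j ⊆ Set.range e := Set.range_subset_iff.mpr fun a => ⟨of _ a, he a⟩
  exact (hj.mono hsub).closure_eq

/-- The universal property of the enveloping C*-algebra. -/
theorem IsCStarEnvelope.exists_lift {j : 𝒜 →⋆ₐ[ℂ] A} (hj : IsCStarEnvelope j)
    (φ : 𝒜 →⋆ₐ[ℂ] B) : ∃ f : A →⋆ₐ[ℂ] B, ∀ a, f (j a) = φ a := by
  let e := StarAlgEquiv.ofBijective _ (CStarSeminorm.Completion.bijective_lift hj.1)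
  -- The norm of `A` bounds all C*-seminorms on `𝒜`, in particular the one induced by `φ`.
  have hφ : ∀ a, ‖φ a‖ ≤ CStarSeminorm.ofHom j a := fun a =>
    (hj.2 a).1 ⟨CStarSeminorm.ofHom φ, rfl⟩
  let ψ := CStarSeminorm.Completion.lift φ hφ
  refine ⟨ψ.comp (e.symm : A →⋆ₐ[ℂ] (CStarSeminorm.ofHom j).Completion), fun a => ?_⟩
  have h : e.symm (j a) = CStarSeminorm.Completion.of _ a :=
    (StarAlgEquiv.symm_apply_eq e).mpr (CStarSeminorm.Completion.lift_of (q := CStarSeminorm.ofHom j) j (fun _ => le_rfl) a).symm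
  exact (congrArg _ h).trans (CStarSeminorm.Completion.lift_of φ hφ a)

/-- If every `*`-homomorphism of a `*`-algebra with a dense map `j` to a C*-algebra `A` factors
through `A`, then `A` is the enveloping C*-algebra. -/
theorem IsCStarEnvelope.of_exists_lift {j : 𝒜 →⋆ₐ[ℂ] A} (hj : DenseRange j)
    (h : ∀ q : CStarSeminorm 𝒜, ∃ f : A →⋆ₐ[ℂ] q.Completion,
      ∀ a, f (j a) = CStarSeminorm.Completion.of q a) : IsCStarEnvelope j := by
  -- The norm pulled back along `j` belongs to the family of C*-seminorms, so any upper bound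
  -- dominates it; only the upper bound property of `‖j a‖` remains.
  refine ⟨hj, fun a => ⟨?_, fun c hc => hc ⟨CStarSeminorm.ofHom j, rfl⟩⟩⟩
  rintro _ ⟨q, rfl⟩
  obtain ⟨f, hf⟩ := h q
  change q a ≤ ‖j a‖
  rw [← CStarSeminorm.Completion.norm_of q a, ← hf]
  exact NonUnitalStarAlgHom.norm_apply_le f _

end Extend

/-! ### The dense subalgebra and the trivial corepresentation -/

namespace WoronowiczAlgebra

variable {A : Type u} [CStarAlgebra A] (W : WoronowiczAlgebra.{u, v} A)

theorem mat_mem_polynomialAlgebra (l : W.Λ) (i j : Fin (W.dim l)) :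
    W.mat l i j ∈ W.polynomialAlgebra :=
  StarAlgebra.subset_adjoin ℂ _ ⟨l, i, j, rfl⟩

theorem denseRange_subtype : DenseRange W.polynomialAlgebra.subtype := by
  refine W.dense_adjoin.mono ?_
  have h : Algebra.adjoin ℂ {a : A | ∃ l i j, a = W.mat l i j} ≤
      W.polynomialAlgebra.toSubalgebra :=
    Algebra.adjoin_le (StarAlgebra.subset_adjoin ℂ _)
  exact fun a ha => ⟨⟨a, h ha⟩, rfl⟩

/-- The same Woronowicz algebra, with the trivial corepresentation added to the family. -/
def addTrivial : WoronowiczAlgebra.{u, v} A where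
  nontrivial := W.nontrivial
  comul := W.comul
  Λ := Option W.Λ
  dim
    | none => 1
    | some l => W.dim l
  mat
    | none => (1 : Matrix (Fin 1) (Fin 1) A)
    | some l => W.mat l
  mat_mem_unitary
    | none => one_mem _
    | some l => W.mat_mem_unitary l
  dense_adjoin := W.dense_adjoin.mono <| Algebra.adjoin_mono <| by
    rintro _ ⟨l, i, j, rfl⟩
    exact ⟨some l, i, j, rfl⟩
  comul_mat
    | none => fun (i : Fin 1) (j : Fin 1) => by
      have h : ∀ i j : Fin 1, (1 : Matrix (Fin 1) (Fin 1) A) i j = 1 := fun i j => by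
        rw [Subsingleton.elim i j, Matrix.one_apply_eq]
      change W.comul ((1 : Matrix (Fin 1) (Fin 1) A) i j) = ∑ k : Fin 1, MinTensor.tmul
        ((1 : Matrix (Fin 1) (Fin 1) A) i k) ((1 : Matrix (Fin 1) (Fin 1) A) k j)
      simp_rw [h, map_one, Fin.sum_univ_one, MinTensor.one_tmul_one]
    | some l => W.comul_mat l
  isUnit_transpose
    | none => by
      change IsUnit (1 : Matrix (Fin 1) (Fin 1) A).transpose
      rw [Matrix.transpose_one]
      exact isUnit_one
    | some l => W.isUnit_transpose l

/-- The added entry is 1, so enlarging the family keeps all entries in the dense star-subalgebra to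
which fullness of `W` refers. -/
theorem addTrivial_mat_mem (l : W.addTrivial.Λ) (i j : Fin (W.addTrivial.dim l)) :
    W.addTrivial.mat l i j ∈ W.polynomialAlgebra :=
  match l, i, j with
  | none, (i : Fin 1), (j : Fin 1) => by
    change (1 : Matrix (Fin 1) (Fin 1) A) i j ∈ W.polynomialAlgebra
    rw [Subsingleton.elim i j, Matrix.one_apply_eq]
    exact one_mem _
  | some l, i, j => W.mat_mem_polynomialAlgebra l i j

end WoronowiczAlgebra

/-! ### The Woronowicz structure from the universal property -/

/-- `E`, with the `*`-homomorphisms `ν i` and the elements `X i j`, has the universal property of the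
free wreath product of `A` by the quantum permutation group. -/
structure IsFreeWreath {A E : Type u} [CStarAlgebra A] [CStarAlgebra E] {n : ℕ}
    (ν : Fin n → A →⋆ₐ[ℂ] E) (X : Fin n → Fin n → E) : Prop where
  magic : IsMagicUnitary X
  commute : ∀ k i a, Commute (ν k a) (X k i)
  eq_top : ∀ S : Subalgebra ℂ E, IsClosed (S : Set E) → (∀ i a, ν i a ∈ S) → (∀ i j, X i j ∈ S) →
    S = ⊤
  -- The targets needed all lie in this universe: `A`, the minimal tensor square of `E`, and
  -- completions of a star-subalgebra of `E`.
  exists_lift : ∀ {B : Type u} [CStarAlgebra B] (f : Fin n → A →⋆ₐ[ℂ] B) (Y : Fin n → Fin n → B),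
    IsMagicUnitary Y → (∀ k i a, Commute (f k a) (Y k i)) →
      ∃ F : E →⋆ₐ[ℂ] B, (∀ i a, F (ν i a) = f i a) ∧ ∀ i j, F (X i j) = Y i j

/-- The interface to the concrete construction: the Woronowicz structure and its fullness are
derived from these properties alone. -/
theorem FreeWreath.isFreeWreath (A : Type u) [CStarAlgebra A] (n : ℕ) :
    IsFreeWreath (FreeWreath.ν (A := A) (n := n)) FreeWreath.x where
  magic := isMagicUnitary_x
  commute := commute_ν_x
  eq_top _ hS hν hx := subalgebra_eq_top hS hν hx
  exists_lift f _ hY hc := ⟨lift f hY hc, lift_ν f hY hc, lift_x f hY hc⟩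

namespace IsFreeWreath

variable {A E : Type u} [CStarAlgebra A] [CStarAlgebra E] {n : ℕ} {ν : Fin n → A →⋆ₐ[ℂ] E}
  {X : Fin n → Fin n → E} (h : IsFreeWreath ν X) (W : WoronowiczAlgebra.{u, v} A)

-- Sending every copy of `A` identically to `A` and `X` to the identity matrix respects the
-- relations, so `E` maps unitally to a nonzero algebra.
include h in
theorem nontrivial [Nontrivial A] : Nontrivial E := by
  obtain ⟨F, -, -⟩ := h.exists_lift (fun _ : Fin n => StarAlgHom.id ℂ A) _ IsMagicUnitary.one
    fun k i a => by
      split_ifs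
      · exact Commute.one_right _
      · exact Commute.zero_right _
  exact F.toAlgHom.toRingHom.domain_nontrivial

/-- The values of the coproduct of the free wreath product on the copies of `A`. -/
noncomputable def comulν (i : Fin n) : A →⋆ₐ[ℂ] MinTensor E E :=
  StarAlgHom.sumProjections (fun k => (MinTensor.map (ν i) (ν k)).comp W.comul)
    (fun k => MinTensor.tmul (X i k) 1)
    (fun k => by rw [MinTensor.star_tmul, h.magic.star_eq, star_one])
    (fun j k => by
      rw [MinTensor.tmul_mul_tmul, h.magic.mul_row, one_mul]
      split_ifs
      · rfl
      · rw [MinTensor.zero_tmul])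
    (by rw [← MinTensor.sum_tmul, h.magic.sum_row, MinTensor.one_tmul_one])
    (fun k a => MinTensor.commute_map_tmul (h.commute i k) (fun b => Commute.one_right _) _)

theorem comulν_apply (i : Fin n) (a : A) : h.comulν W i a =
    ∑ k, MinTensor.map (ν i) (ν k) (W.comul a) * MinTensor.tmul (X i k) 1 := rfl

/-- The factor `X k m` from the first sum meets `X k l` from the second, and row orthogonality kills
the terms with `m ≠ l`. In what remains both legs of `X k l ⊗ X l i` commute with the corresponding
legs of the homomorphism, which is not true of the factors taken separately from the start. -/
theorem comulν_mul (k i : Fin n) (a : A) :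
    h.comulν W k a * ∑ l, MinTensor.tmul (X k l) (X l i) =
      ∑ l, MinTensor.map (ν k) (ν l) (W.comul a) * MinTensor.tmul (X k l) (X l i) := by
  rw [comulν_apply, Finset.sum_mul_sum]
  refine Finset.sum_congr rfl fun l _ => ?_
  rw [Finset.sum_eq_single l]
  · rw [mul_assoc, MinTensor.tmul_mul_tmul, h.magic.mul_row, if_pos rfl, one_mul]
  · intro m _ hm
    rw [mul_assoc, MinTensor.tmul_mul_tmul, h.magic.mul_row, if_neg hm.symm,
      MinTensor.zero_tmul, mul_zero]
  · exact fun hl => absurd (Finset.mem_univ l) hl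

theorem commute_comulν (k i : Fin n) (a : A) :
    Commute (h.comulν W k a) (∑ l, MinTensor.tmul (X k l) (X l i)) := by
  have hX := h.magic.tensor.star_eq k i
  -- Each term left by `comulν_mul` is a product of commuting factors, so taking adjoints amounts to
  -- replacing `b` by `star b`. As the sum of tensors is self-adjoint, the adjoint on the right is
  -- the product in the opposite order.
  have hs : ∀ b : A, h.comulν W k b * ∑ l, MinTensor.tmul (X k l) (X l i) =
      star (h.comulν W k (star b) * ∑ l, MinTensor.tmul (X k l) (X l i)) := fun b => by
    simp_rw [comulν_mul, star_sum, star_mul, ← map_star, star_star, MinTensor.star_tmul,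
      h.magic.star_eq]
    exact Finset.sum_congr rfl fun l _ =>
      (MinTensor.commute_map_tmul (h.commute k l) (h.commute l i) _).eq
  refine (hs a).trans ?_
  rw [star_mul, ← map_star, star_star, hX]

/-- The coproduct of the free wreath product. -/
noncomputable def comul : E →⋆ₐ[ℂ] MinTensor E E :=
  (h.exists_lift (h.comulν W) _ h.magic.tensor (h.commute_comulν W)).choose

theorem comul_ν (i : Fin n) (a : A) : h.comul W (ν i a) =
    ∑ k, MinTensor.map (ν i) (ν k) (W.comul a) * MinTensor.tmul (X i k) 1 :=
  (h.exists_lift (h.comulν W) _ h.magic.tensor (h.commute_comulν W)).choose_spec.1 i a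

theorem comul_X (i j : Fin n) : h.comul W (X i j) = ∑ k, MinTensor.tmul (X i k) (X k j) :=
  (h.exists_lift (h.comulν W) _ h.magic.tensor (h.commute_comulν W)).choose_spec.2 i j

theorem comul_ν_mul_X (i j : Fin n) (a : A) : h.comul W (ν i a * X i j) =
    ∑ k, MinTensor.map (ν i) (ν k) (W.comul a) * MinTensor.tmul (X i k) (X k j) := by
  rw [map_mul, comul_ν, comul_X, ← comulν_apply h, comulν_mul]

variable (ν X) in
/-- The matrix with entries `ν i (u a b) * X i j`, for the member `u` with index `l` of the family
of `W`, or for `u = 1`. -/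
def mat (l : W.addTrivial.Λ) :
    Matrix (Fin (n * W.addTrivial.dim l)) (Fin (n * W.addTrivial.dim l)) E :=
  ((W.addTrivial.mat l).rowBlock (fun i => (ν i : A →+* E)) X).submatrix
    finProdFinEquiv.symm finProdFinEquiv.symm

theorem mat_apply (l : W.addTrivial.Λ) (i j : Fin n) (a b : Fin (W.addTrivial.dim l)) :
    mat ν X W l (finProdFinEquiv (i, a)) (finProdFinEquiv (j, b)) =
      ν i (W.addTrivial.mat l a b) * X i j := by
  simp [mat, Matrix.rowBlock]

theorem exists_mat_iff (y : E) : (∃ l p q, y = mat ν X W l p q) ↔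
    ∃ l i j a b, y = ν i (W.addTrivial.mat l a b) * X i j := by
  constructor
  · rintro ⟨l, p, q, rfl⟩
    exact ⟨l, _, _, _, _, rfl⟩
  · rintro ⟨l, i, j, a, b, rfl⟩
    exact ⟨l, _, _, (mat_apply W l i j a b).symm⟩

/-- Comes from the trivial corepresentation, whose only entry is 1; this is why it was added to the
family. -/
theorem X_eq (i j : Fin n) : ∃ l p q, X i j = mat ν X W l p q := by
  refine (exists_mat_iff W _).mpr ⟨none, i, j, (0 : Fin 1), (0 : Fin 1), ?_⟩
  change _ = ν i ((1 : Matrix (Fin 1) (Fin 1) A) 0 0) * X i j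
  rw [Matrix.one_apply_eq, map_one, one_mul]

-- The factor `X i j` is removed by summing over `j`, since the rows of `X` sum to 1.
include h in
theorem ν_mem {S : Subalgebra ℂ E} (hS : ∀ l p q, mat ν X W l p q ∈ S) (l : W.addTrivial.Λ)
    (i : Fin n) (a b : Fin (W.addTrivial.dim l)) : ν i (W.addTrivial.mat l a b) ∈ S := by
  rw [← mul_one (ν i _), ← h.magic.sum_row i, Finset.mul_sum]
  refine sum_mem fun j _ => ?_
  rw [← mat_apply]
  exact hS _ _ _

include h in
theorem mat_mem_unitary (l : W.addTrivial.Λ) : mat ν X W l ∈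
    unitary (Matrix (Fin (n * W.addTrivial.dim l)) (Fin (n * W.addTrivial.dim l)) E) := by
  have hl := W.addTrivial.mat_mem_unitary l
  rw [Unitary.mem_iff, Matrix.star_eq_conjTranspose] at hl ⊢
  have hc : ∀ k i a, Commute ((ν k : A →+* E) a) (X k i) := h.commute
  rw [mat, Matrix.conjTranspose_submatrix,
    Matrix.conjTranspose_rowBlock h.magic hc fun k a => map_star (ν k) a,
    Matrix.submatrix_mul_equiv, Matrix.submatrix_mul_equiv,
    h.magic.rowBlock_mul_colBlock hc hl.2,
    h.magic.colBlock_mul_rowBlock hc hl.1, Matrix.submatrix_one_equiv]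
  exact ⟨rfl, rfl⟩

-- If `V` is inverse to the transpose of the original matrix, the row block of `V` is inverse to the
-- transposed row block, which is a column block.
include h in
theorem isUnit_transpose (l : W.addTrivial.Λ) : IsUnit (mat ν X W l).transpose := by
  obtain ⟨V, hV1, hV2⟩ := isUnit_iff_exists.mp (W.addTrivial.isUnit_transpose l)
  refine isUnit_iff_exists.mpr ⟨(V.rowBlock (fun i => (ν i : A →+* E)) X).submatrix
    finProdFinEquiv.symm finProdFinEquiv.symm, ?_⟩
  have hc : ∀ k i a, Commute ((ν k : A →+* E) a) (X k i) := h.commute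
  rw [mat, Matrix.transpose_submatrix, Matrix.transpose_rowBlock, Matrix.submatrix_mul_equiv,
    Matrix.submatrix_mul_equiv, h.magic.rowBlock_mul_colBlock hc hV2,
    h.magic.colBlock_mul_rowBlock hc hV1, Matrix.submatrix_one_equiv]
  exact ⟨rfl, rfl⟩

include h in
theorem dense_adjoin :
    Dense (Algebra.adjoin ℂ {y : E | ∃ l p q, y = mat ν X W l p q} : Set E) := by
  set T := Algebra.adjoin ℂ {y : E | ∃ l p q, y = mat ν X W l p q}
  let S := T.topologicalClosure
  have hS : IsClosed (S : Set E) := Subalgebra.isClosed_topologicalClosure _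
  have hle : T ≤ S := Subalgebra.le_topologicalClosure _
  have hν : ∀ i a, ν i a ∈ S := fun i a => by
    have h2 : Algebra.adjoin ℂ {a : A | ∃ l i j, a = W.addTrivial.mat l i j} ≤
        S.comap (ν i).toAlgHom := Algebra.adjoin_le <| by
      rintro _ ⟨l, b, c, rfl⟩
      exact hle (h.ν_mem W (S := T) (fun l p q => Algebra.subset_adjoin ⟨l, p, q, rfl⟩) l i b c)
    -- The preimage of `S` under `ν i` is closed and contains the dense subalgebra generated by the
    -- matrix entries in `A`.
    exact (hS.preimage (StarAlgHom.continuous_of_cstarAlgebra (ν i))).closure_subset_iff.mpr h2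
      (W.addTrivial.dense_adjoin a)
  have hT : S = ⊤ := h.eq_top S hS hν fun i j => hle (Algebra.subset_adjoin (X_eq W i j))
  exact fun y => hT.ge (Algebra.mem_top (x := y))

/-- The summation index `r` is a pair `(k, c)`: `k` comes from the coproduct of `X`, and `c` from
that of the matrix over `A`. -/
theorem comul_mat (l : W.addTrivial.Λ) (p q : Fin (n * W.addTrivial.dim l)) :
    h.comul W (mat ν X W l p q) =
      ∑ r, MinTensor.tmul (mat ν X W l p r) (mat ν X W l r q) := by
  obtain ⟨⟨i, a⟩, rfl⟩ := finProdFinEquiv.surjective p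
  obtain ⟨⟨j, b⟩, rfl⟩ := finProdFinEquiv.surjective q
  have hd : W.comul (W.addTrivial.mat l a b) = _ := W.addTrivial.comul_mat l a b
  rw [mat_apply, comul_ν_mul_X, hd, ← Equiv.sum_comp finProdFinEquiv, Fintype.sum_prod_type]
  refine Finset.sum_congr rfl fun k _ => ?_
  rw [map_sum, Finset.sum_mul]
  refine Finset.sum_congr rfl fun c _ => ?_
  rw [MinTensor.map_tmul, MinTensor.tmul_mul_tmul, mat_apply, mat_apply]

/-- The Woronowicz algebra structure of the free wreath product, with the family of unitary
matrices `ν i (u a b) * X i j` at `((i, a), (j, b))`. -/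
noncomputable def woronowicz : WoronowiczAlgebra.{u, v} E where
  nontrivial := have := W.nontrivial; h.nontrivial
  comul := h.comul W
  Λ := W.addTrivial.Λ
  dim l := n * W.addTrivial.dim l
  mat := mat ν X W
  mat_mem_unitary := h.mat_mem_unitary W
  dense_adjoin := h.dense_adjoin W
  comul_mat := h.comul_mat W
  isUnit_transpose := h.isUnit_transpose W

/-! ### Fullness of the free wreath product -/

theorem X_mem (i j : Fin n) : X i j ∈ (h.woronowicz W).polynomialAlgebra :=
  StarAlgebra.subset_adjoin ℂ _ (X_eq W i j)

theorem polynomialAlgebra_le_comap (i : Fin n) :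
    W.polynomialAlgebra ≤ (h.woronowicz W).polynomialAlgebra.comap (ν i) := by
  refine StarAlgebra.adjoin_le ?_
  rintro _ ⟨l, a, b, rfl⟩
  exact h.ν_mem W (S := (h.woronowicz W).polynomialAlgebra.toSubalgebra)
    (h.woronowicz W).mat_mem_polynomialAlgebra (some l) i a b

/-- The restriction of `ν i` to the dense `*`-subalgebras. -/
noncomputable def polynomialν (i : Fin n) :
    W.polynomialAlgebra →⋆ₐ[ℂ] (h.woronowicz W).polynomialAlgebra :=
  ((ν i).comp W.polynomialAlgebra.subtype).codRestrict _ fun a =>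
    h.polynomialAlgebra_le_comap W i a.2

theorem isMagicUnitary_polynomial : IsMagicUnitary fun i j : Fin n =>
    (⟨X i j, h.X_mem W i j⟩ : (h.woronowicz W).polynomialAlgebra) :=
  .of_map (h.woronowicz W).polynomialAlgebra.subtype Subtype.val_injective h.magic

variable {W} in
/-- The free wreath product of a full Woronowicz algebra is full. -/
theorem isFull (hW : W.IsFull) : (h.woronowicz W).IsFull := by
  refine IsCStarEnvelope.of_exists_lift (h.woronowicz W).denseRange_subtype fun q => ?_
  let π := CStarSeminorm.Completion.of q
  -- Fullness of `W` extends each restriction of `π` to a copy of the dense subalgebra to a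
  -- homomorphism defined on all of `A`.
  choose f hf using fun i : Fin n => hW.exists_lift (π.comp (h.polynomialν W i))
  -- The relation holds on the dense star-subalgebra, where `f k` is computed by `π`, and extends to
  -- `A` by continuity.
  have hc : ∀ k i a, Commute (f k a) (π ⟨X k i, h.X_mem W k i⟩) := fun k i a => by
    have hcont := StarAlgHom.continuous_of_cstarAlgebra (f k)
    refine W.denseRange_subtype.induction_on
      (p := fun a => f k a * π ⟨X k i, h.X_mem W k i⟩ = π ⟨X k i, h.X_mem W k i⟩ * f k a) a
      (isClosed_eq (hcont.mul continuous_const) (continuous_const.mul hcont)) fun b => ?_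
    rw [hf, StarAlgHom.comp_apply, ← map_mul, ← map_mul]
    exact congrArg π (Subtype.ext (h.commute k i (b : A)).eq)
  obtain ⟨F, hFν, hFX⟩ := h.exists_lift f _ ((h.isMagicUnitary_polynomial W).map π) hc
  refine ⟨F, fun a => ?_⟩
  have hF : F.comp (h.woronowicz W).polynomialAlgebra.subtype = π := by
    refine StarAlgHom.ext_adjoin ?_
    rintro ⟨y, hy⟩ hy'
    obtain ⟨l, i, j, b, c, rfl⟩ := (exists_mat_iff W y).mp hy'
    -- The values of `f i` are tied to `π` only on `W.polynomialAlgebra`, so the entry must be known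
    -- to lie there.
    have hu := W.addTrivial_mat_mem l b c
    change F (ν i (W.addTrivial.mat l b c) * X i j) = _
    rw [map_mul, hFν, hFX]
    refine (congrArg (· * _) (hf i ⟨_, hu⟩)).trans ?_
    rw [StarAlgHom.comp_apply, ← map_mul]
    rfl
  exact DFunLike.congr_fun hF a

end IsFreeWreath

theorem theorem3p2 {A : Type u} [CStarAlgebra A] (W : WoronowiczAlgebra.{u, v} A)
    (n : ℕ) (hn : 0 < n) :
    ∃ W' : WoronowiczAlgebra.{u, v} (FreeWreath A n),
      (∀ i j : Fin n, W'.comul (FreeWreath.x i j) =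
        ∑ k : Fin n, MinTensor.tmul (FreeWreath.x i k) (FreeWreath.x k j)) ∧
      (∀ (i : Fin n) (a : A), W'.comul (FreeWreath.ν i a) =
        ∑ k : Fin n, MinTensor.map (FreeWreath.ν i) (FreeWreath.ν k) (W.comul a) *
          MinTensor.tmul (FreeWreath.x i k) 1) ∧
      (W.IsFull → W'.IsFull) :=
  have h := FreeWreath.isFreeWreath A n
  ⟨h.woronowicz W, h.comul_X W, h.comul_ν W, h.isFull⟩
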